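/- Let $\Omega\subseteq\mathbb R^3$ be open, $T_e>0$, let $T\in C([0,T_e]\times\overline\Omega,\mathcal S^3)$ be a given field of symmetric $3\times3$ matrices, $f:\mathbb R\to\mathbb R$ continuous and odd, $g\in\mathbb R^3$ a unit vector and $b\in\mathbb R^3\setminus\{0\}$ a Burgers vector with $b\cdot g=0$. A dislocation measure on $\Omega$ is a vector measure $\rho=\tau|\rho|$ with a nonnegative Radon measure $|\rho|$ on $\Omega$, a continuous field $\tau$ of unit vectors on $\operatorname{supp}|\rho|$, and $\rho=\operatorname{rot}h$ in the sense of distributions for some $h\in L^{1}_{\rm loc}(\Omega,\mathbb R^3)$. Let $\ell(t)$, $t\in[0,T_e)$, be a moving embedded $C^1$ curve in $\Omega$ (given by a parametrization $y(t,s)$ that is jointly $C^1$ on $[0,T_e)\times\mathbb R$ with $\partial_sy\ne0$) without end points in $\Omega$: either closed, or parametrized injectively by $s\in\mathbb R$ and leaving every compact subset of $\Omega$ as $|s|\to\infty$, locally uniformly in $t\in[0,T_e)$. Let $\tau(x,t)$ be its unit tangent vector at $x\in\ell(t)$. Assume that for every $t\in[0,T_e)$ the curve $\ell(t)$ is contained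 in a plane normal to $g$, and that there is a dislocation measure $\rho_{\ell(t)}=\tau|\rho_{\ell(t)}|$ on $\Omega$ with $$\langle\rho_{\ell(t)},\varphi\rangle=|b|\int_{\ell(t)}\tau\cdot\varphi\,ds .$$ Let $F=\tau\times Tb$. Where $\tau$ and $b$ are not parallel, let $b^{\perp\tau}$ be the unit vector in the direction of the orthogonal projection $b-(b\cdot\tau)\tau$ of $b$ to the orthogonal space of $\tau$; where they are parallel (screw points), let $b^{\perp\tau}$ be one of the two unit vectors $\pm\,\tau\times g$ (since $f$ is odd, $f(b^{\perp\tau}\cdot F)\,b^{\perp\tau}$ does not depend on the choice). The normal velocity $v(x_0,t_0)$ of the curve at $x_0\in\ell(t_0)$ is $\frac{d}{dt}x(t)|_{t=t_0}$ (one-sided if $t_0=0$), where $x(t)$ is the intersection point of $\ell(t)$, near $x_0$, with the plane through $x_0$ normal to $\tau(x_0,t_0)$. Then $\rho_{\ell(t)}$ is a weak solution of $$\partial_t\rho=\operatorname{rot}\big(g\,f(g\cdot Tb)\,|\rho|\big),$$ that is, for all $\varphi\in C_0^\infty((0,T_e)\times\Omega,\mathbb R^3)$ the integrals in $$-\int_0^{T_e}\langle\rho(t),\partial_t\varphi(t)\rangle\,dt=\int_0^{T_e}\big\langle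 g\,f(g\cdot Tb)\,|\rho(t)|,\operatorname{rot}_x\varphi(t)\big\rangle\,dt$$ exist and satisfy this equation, if and only if for all $t\in[0,T_e)$ and all $x\in\ell(t)$ the normal velocity is $$v(x,t)=f\big(b^{\perp\tau}\cdot F\big)\,b^{\perp\tau}.$$ If moreover the set of $(t,s)$ for which $\tau(y(t,s),t)$ and $b$ are not parallel is dense in $[0,T_e)\times\mathbb R$, then the equivalence also holds with the velocity condition required only at the points that are not screw points. -/

import Mathlib

open Set Filter Topology MeasureTheory
open scoped ContDiff

noncomputable section

namespace Dislocation

/-- Euclidean three-space. -/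
abbrev E3 : Type := EuclideanSpace ℝ (Fin 3)

/-- The cross product of Euclidean three-space. -/
def cross (u v : E3) : E3 := WithLp.toLp 2 (crossProduct u.ofLp v.ofLp)

/-- A matrix applied to a vector of Euclidean three-space. -/
def mulVec3 (A : Matrix (Fin 3) (Fin 3) ℝ) (v : E3) : E3 := WithLp.toLp 2 (A.mulVec v.ofLp)

/-- The partial derivative `∂ᵢ ψⱼ` of a vector field at `x`. -/
def partialDeriv (i j : Fin 3) (ψ : E3 → E3) (x : E3) : ℝ :=
  fderiv ℝ ψ x (EuclideanSpace.single i 1) j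

/-- The rotation (curl) of a differentiable vector field. -/
def rot (ψ : E3 → E3) (x : E3) : E3 :=
  !₂[partialDeriv 1 2 ψ x - partialDeriv 2 1 ψ x,
     partialDeriv 2 0 ψ x - partialDeriv 0 2 ψ x,
     partialDeriv 0 1 ψ x - partialDeriv 1 0 ψ x]

/-- `ψ ∈ C₀^∞(Ω, ℝ³)`, as a function on the whole space. -/
def IsTestField (Ω : Set E3) (ψ : E3 → E3) : Prop :=
  ContDiff ℝ ∞ ψ ∧ HasCompactSupport ψ ∧ tsupport ψ ⊆ Ω

/-- `φ ∈ C₀^∞((0, Te) × Ω, ℝ³)`, as a function of time and space. -/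
def IsSpaceTimeTestField (Ω : Set E3) (Te : ℝ) (φ : ℝ → E3 → E3) : Prop :=
  ContDiff ℝ ∞ (fun p : ℝ × E3 => φ p.1 p.2) ∧
  HasCompactSupport (fun p : ℝ × E3 => φ p.1 p.2) ∧
  tsupport (fun p : ℝ × E3 => φ p.1 p.2) ⊆ Ioo 0 Te ×ˢ Ω

/-- A vector valued dislocation measure `ρ = τ μ` on `Ω`: `μ = |ρ|` is a nonnegative Radon measure
on `Ω` (locally finite in `Ω`, no mass outside), `τ = ρ / |ρ|` is a continuous field of unit
vectors on the support of `μ` in `Ω` (its values elsewhere are irrelevant), and `ρ = rot h` in the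
sense of distributions on `Ω` for some locally integrable vector field `h` on `Ω`. -/
structure DislocationMeasure (Ω : Set E3) where
  /-- the scalar measure `|ρ|` -/
  total : Measure E3
  /-- the direction field `ρ / |ρ|` -/
  dir : E3 → E3
  total_compl : total Ωᶜ = 0
  total_compact : ∀ K : Set E3, IsCompact K → K ⊆ Ω → total K < ⊤
  dir_continuousOn : ContinuousOn dir (total.support ∩ Ω)
  dir_norm : ∀ x ∈ total.support ∩ Ω, ‖dir x‖ = 1
  exists_rot : ∃ h : E3 → E3, LocallyIntegrableOn h Ω volume ∧
    ∀ ψ : E3 → E3, IsTestField Ω ψ →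
      ∫ x, inner ℝ (dir x) (ψ x) ∂total = ∫ x, inner ℝ (h x) (rot ψ x)

/-- The pairing `⟨β μ, φ⟩ = ∫ β · φ dμ` of the vector valued measure `β μ` with a vector field. -/
def pairing (μ : Measure E3) (β φ : E3 → E3) : ℝ := ∫ x, inner ℝ (β x) (φ x) ∂μ

/-- The time dependent dislocation measure `ρ : [0, Te) → M_d(Ω)` is a (weak) solution of
`∂ₜ ρ = rot (g f(g · T b) |ρ|)`: for all test fields `φ` the two time integrals exist and
`- ∫ ⟨ρ(t), ∂ₜ φ(t)⟩ dt = ∫ ⟨g f(g · T b) |ρ(t)|, rot φ(t)⟩ dt`. -/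
def SolvesSlipPlaneEquation {Ω : Set E3} (Te : ℝ) (f : ℝ → ℝ)
    (T : ℝ → E3 → Matrix (Fin 3) (Fin 3) ℝ) (b g : E3) (ρ : ℝ → DislocationMeasure Ω) : Prop :=
  ∀ φ : ℝ → E3 → E3, IsSpaceTimeTestField Ω Te φ →
    IntegrableOn
      (fun t => pairing (ρ t).total (ρ t).dir (fun x => deriv (fun r => φ r x) t)) (Ioo 0 Te) ∧
    IntegrableOn
      (fun t => pairing (ρ t).total (fun x => f (inner ℝ g (mulVec3 (T t x) b)) • g)
        (rot (φ t))) (Ioo 0 Te) ∧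
    - ∫ t in Ioo 0 Te, pairing (ρ t).total (ρ t).dir (fun x => deriv (fun r => φ r x) t) =
      ∫ t in Ioo 0 Te, pairing (ρ t).total (fun x => f (inner ℝ g (mulVec3 (T t x) b)) • g)
        (rot (φ t))

/-- A moving `C¹` curve in `Ω` during `[0, Te)`, given by a parametrization `y t s` (`t` is the
time, `s` the curve parameter) that is regular for every time, jointly `C¹` (one-sided at `t = 0`),
and runs through the curve once, without self-intersections, as `s` runs through `dom`. The curve
has no end point in `Ω`: either it is closed (`y t` is periodic and `dom` is one period), or it is
an infinite line or reaches the boundary of `Ω` at both ends (`dom` is the real line, and the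
parametrization leaves every compact subset of `Ω`, locally uniformly in time). -/
structure MovingCurve (Ω : Set E3) (Te : ℝ) where
  y : ℝ → ℝ → E3
  dom : Set ℝ
  contDiffOn : ContDiffOn ℝ 1 (fun p : ℝ × ℝ => y p.1 p.2) (Ico 0 Te ×ˢ univ)
  regular : ∀ t ∈ Ico 0 Te, ∀ s, deriv (y t) s ≠ 0
  mem : ∀ t ∈ Ico 0 Te, ∀ s, y t s ∈ Ω
  injOn : ∀ t ∈ Ico 0 Te, InjOn (y t) dom
  closed_or_open :
    (∃ L : ℝ, 0 < L ∧ dom = Ioc 0 L ∧ ∀ t ∈ Ico 0 Te, Function.Periodic (y t) L) ∨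
    (dom = univ ∧ ∀ K : Set E3, IsCompact K → K ⊆ Ω → ∀ J : Set ℝ, IsCompact J → J ⊆ Ico 0 Te →
      Bornology.IsBounded {s : ℝ | ∃ t ∈ J, y t s ∈ K})

namespace MovingCurve

variable {Ω : Set E3} {Te : ℝ}

/-- The curve `ℓ(t)` as a set. -/
def curve (ℓ : MovingCurve Ω Te) (t : ℝ) : Set E3 := range (ℓ.y t)

/-- The unit tangent vector of `ℓ(t)` at the point `ℓ.y t s`. -/
def tangent (ℓ : MovingCurve Ω Te) (t s : ℝ) : E3 := ‖deriv (ℓ.y t) s‖⁻¹ • deriv (ℓ.y t) s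

/-- The arc length measure of `ℓ(t)`: `∫ φ d(arcLength t) = ∫_{dom} φ(y t s) |∂ₛ y t s| ds`. -/
def arcLength (ℓ : MovingCurve Ω Te) (t : ℝ) : Measure E3 :=
  Measure.map (ℓ.y t)
    ((volume.restrict ℓ.dom).withDensity (fun s => ENNReal.ofReal ‖deriv (ℓ.y t) s‖))

/-- `ρ` is the dislocation measure of `ℓ(t)` to the Burgers vector `b`, that is
`⟨ρ, φ⟩ = |b| ∫_{ℓ(t)} τ · φ ds`: `|ρ|` is `|b|` times arc length, and `ρ / |ρ|` is the unit
tangent vector field. -/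
def IsDislocationMeasureOf (ℓ : MovingCurve Ω Te) (b : E3) (t : ℝ)
    (ρ : DislocationMeasure Ω) : Prop :=
  ρ.total = ENNReal.ofReal ‖b‖ • ℓ.arcLength t ∧ ∀ s, ρ.dir (ℓ.y t s) = ℓ.tangent t s

/-- `v` is the normal velocity of the moving curve at time `t₀ ∈ [0, Te)` at the point
`x₀ = ℓ.y t₀ s₀`: the intersection point `x(t)` of `ℓ(t)` with the plane through `x₀` normal to
the tangent vector at `x₀` has time derivative `v` at `t₀` (one-sided for `t₀ = 0`). -/
def HasNormalVelocityAt (ℓ : MovingCurve Ω Te) (t₀ s₀ : ℝ) (v : E3) : Prop :=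
  ∃ x : ℝ → E3, x t₀ = ℓ.y t₀ s₀ ∧
    (∀ᶠ t in 𝓝[Ico 0 Te] t₀,
      x t ∈ ℓ.curve t ∧ inner ℝ (x t - ℓ.y t₀ s₀) (ℓ.tangent t₀ s₀) = 0) ∧
    HasDerivWithinAt x v (Ico 0 Te) t₀

end MovingCurve

/-- The orthogonal projection of `b` to the orthogonal space of the unit vector `τ`. -/
def projNormal (τ b : E3) : E3 := b - inner ℝ τ b • τ

/-- The unit vector `b^{⊥τ}` in the direction of the projection of `b` to the orthogonal space of
`τ`; meaningful if `b` and `τ` are not parallel. -/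
def bPerp (τ b : E3) : E3 := ‖projNormal τ b‖⁻¹ • projNormal τ b

open Classical in
/-- The direction `b^{⊥τ}` in the slip plane normal to `g`, completed at the screw points (where
`τ` and `b` are parallel) by a unit vector of the slip plane that is normal to `τ`. There are two
such vectors, `τ × g` and `-(τ × g)`; for an odd function `f` and a vector `F` the vector
`f(ν · F) ν` is the same for both choices of `ν`. -/
def glideDir (g τ b : E3) : E3 := if projNormal τ b = 0 then cross τ g else bPerp τ b

/-- The Peach-Koehler force `F = τ × T b`. -/
def peachKoehler (A : Matrix (Fin 3) (Fin 3) ℝ) (τ b : E3) : E3 := cross τ (mulVec3 A b)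

/-- The vector `f(ν · F) ν`. -/
def speedAlong (f : ℝ → ℝ) (ν F : E3) : E3 := f (inner ℝ ν F) • ν

end Dislocation

end

open Dislocation

namespace Dislocation

/-! Since `τ` and `b` are both orthogonal to the unit vector `g`, the vector `b^{⊥τ}` can only be
`±τ × g`, and `(τ × g) · (τ × Tb) = g · Tb`. Because `f` is odd the sign is irrelevant, and the
prescribed velocity is `f(g · Tb) τ × g`, also at screw points (`speedAlong_glideDir`).

The bridge to the weak equation is the transport formula `d/dt ∫ φ · ∂ₛy ds = ∫ (∂ₜφ · ∂ₛy + rot φ ·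
(∂ₜy × ∂ₛy)) ds` (`Window.hasDerivAt_lineIntegral`). For a test field the time integral of the left
side is zero, so the difference of the two sides of the weak equation is `|b| ∬ rot φ · defect ds
dt` with `defect = ∂ₜy × ∂ₛy - f(g · Tb) |∂ₛy| g` (`Window.weak_identity`). The defect vanishes
exactly where the normal part of `∂ₜy` is `f(g · Tb) τ × g` (`defect_eq_zero_iff`), and this normal
part is the geometric normal velocity (`hasNormalVelocityAt_iff`). Hence the velocity law implies
the equation.

For the converse, products `χ(t) ψ(x)` show that at each interior time the defect annihilates the
rotations of all test fields near a given point of the curve. The defect is normal to the curve, and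
a test field concentrated at the point, chosen so that its rotation has a positive product with the
defect there, forces the defect to vanish (`eq_zero_of_forall_integral_rot_eq_zero`). Continuity of
the defect then reaches `t = 0`, and also the screw points when the other points are dense. -/

/-! ### Cross product and rotation in coordinates. -/

lemma inner_e3 (u v : E3) : inner ℝ u v = u 0 * v 0 + u 1 * v 1 + u 2 * v 2 := by
  simp [PiLp.inner_apply, Fin.sum_univ_three, mul_comm]

lemma cross_zero (u v : E3) : cross u v 0 = u 1 * v 2 - u 2 * v 1 := by
  simp [cross, crossProduct]

lemma cross_one (u v : E3) : cross u v 1 = u 2 * v 0 - u 0 * v 2 := by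
  simp [cross, crossProduct]

lemma cross_two (u v : E3) : cross u v 2 = u 0 * v 1 - u 1 * v 0 := by
  simp [cross, crossProduct]

lemma e3_ext {u v : E3} (h0 : u 0 = v 0) (h1 : u 1 = v 1) (h2 : u 2 = v 2) : u = v := by
  ext i; fin_cases i <;> assumption

lemma inner_cross_cross (a b c d : E3) :
    inner ℝ (cross a b) (cross c d) = inner ℝ a c * inner ℝ b d - inner ℝ a d * inner ℝ b c := by
  simp only [inner_e3, cross_zero, cross_one, cross_two]; ring

lemma cross_cross (a b c : E3) :
    cross a (cross b c) = inner ℝ a c • b - inner ℝ a b • c := by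
  apply e3_ext <;>
    simp only [inner_e3, cross_zero, cross_one, cross_two, PiLp.sub_apply, PiLp.smul_apply,
      smul_eq_mul] <;> ring

lemma inner_cross_self_right (a b : E3) : inner ℝ (cross a b) b = 0 := by
  simp only [inner_e3, cross_zero, cross_one, cross_two]; ring

lemma inner_cross_self_left (a b : E3) : inner ℝ (cross a b) a = 0 := by
  simp only [inner_e3, cross_zero, cross_one, cross_two]; ring

lemma cross_smul_right (a b : E3) (r : ℝ) : cross a (r • b) = r • cross a b := by
  apply e3_ext <;>
    simp only [cross_zero, cross_one, cross_two, PiLp.smul_apply, smul_eq_mul] <;> ring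

lemma cross_smul_left (a b : E3) (r : ℝ) : cross (r • a) b = r • cross a b := by
  apply e3_ext <;>
    simp only [cross_zero, cross_one, cross_two, PiLp.smul_apply, smul_eq_mul] <;> ring

lemma cross_anticomm (a b : E3) : cross a b = - cross b a := by
  apply e3_ext <;>
    simp only [cross_zero, cross_one, cross_two, PiLp.neg_apply] <;> ring

lemma cross_self (a : E3) : cross a a = 0 := by
  apply e3_ext <;> simp [cross_zero, cross_one, cross_two, mul_comm]

lemma cross_sub_left (a b c : E3) : cross (a - b) c = cross a c - cross b c := by
  apply e3_ext <;>
    simp only [cross_zero, cross_one, cross_two, PiLp.sub_apply] <;> ring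

lemma continuous_cross : Continuous (fun p : E3 × E3 => cross p.1 p.2) := by
  refine (PiLp.continuous_toLp 2 _).comp (continuous_pi fun i => ?_)
  fin_cases i <;> simp [crossProduct] <;> fun_prop

lemma e3_eq_sum (u : E3) : u = u 0 • EuclideanSpace.single 0 (1 : ℝ) +
    u 1 • EuclideanSpace.single 1 (1 : ℝ) + u 2 • EuclideanSpace.single 2 (1 : ℝ) := by
  apply e3_ext <;> simp

lemma rot_zero (ψ : E3 → E3) (x : E3) :
    rot ψ x 0 = partialDeriv 1 2 ψ x - partialDeriv 2 1 ψ x := by simp [rot]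
lemma rot_one (ψ : E3 → E3) (x : E3) :
    rot ψ x 1 = partialDeriv 2 0 ψ x - partialDeriv 0 2 ψ x := by simp [rot]
lemma rot_two (ψ : E3 → E3) (x : E3) :
    rot ψ x 2 = partialDeriv 0 1 ψ x - partialDeriv 1 0 ψ x := by simp [rot]

lemma clm_e3_apply {F : Type*} [NormedAddCommGroup F] [NormedSpace ℝ F] (A : E3 →L[ℝ] F) (u : E3) :
    A u = u 0 • A (EuclideanSpace.single 0 1) + u 1 • A (EuclideanSpace.single 1 1) +
      u 2 • A (EuclideanSpace.single 2 1) := by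
  conv_lhs => rw [e3_eq_sum u]
  simp

/-- The antisymmetric part of the derivative of a vector field is given by its rotation. -/
lemma inner_rot_cross (ψ : E3 → E3) (x u v : E3) :
    inner ℝ (fderiv ℝ ψ x u) v - inner ℝ (fderiv ℝ ψ x v) u = inner ℝ (rot ψ x) (cross u v) := by
  rw [clm_e3_apply _ u, clm_e3_apply _ v]
  simp only [inner_e3, rot_zero, rot_one, rot_two, cross_zero, cross_one, cross_two, partialDeriv,
    PiLp.add_apply, PiLp.smul_apply, smul_eq_mul]
  ring

/-- This is `rot(ζ e) = ∇ζ × e` together with the cyclic symmetry of the triple product. It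
evaluates the concentrated test fields, which have a fixed direction. -/
lemma inner_rot_smul_const {ζ : E3 → ℝ} {x : E3} {ζ' : E3 →L[ℝ] ℝ} (hζ : HasFDerivAt ζ ζ' x)
    (e m : E3) : inner ℝ (rot (fun x => ζ x • e) x) m = ζ' (cross e m) := by
  have h : fderiv ℝ (fun x => ζ x • e) x = ζ'.smulRight e := (hζ.smul_const e).fderiv
  rw [clm_e3_apply ζ' (cross e m)]
  simp only [inner_e3, rot_zero, rot_one, rot_two, cross_zero, cross_one, cross_two, partialDeriv,
    h, ContinuousLinearMap.smulRight_apply, PiLp.smul_apply, smul_eq_mul]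
  ring

/-! ### The glide direction and the prescribed velocity. -/

/-- Triple product rule for an orthonormal pair: `(τ × g) · (τ × w) = g · w`. -/
lemma inner_cross_peachKoehler {τ g : E3} (hτ : ‖τ‖ = 1) (hτg : inner ℝ τ g = 0)
    (A : Matrix (Fin 3) (Fin 3) ℝ) (b : E3) :
    inner ℝ (cross τ g) (peachKoehler A τ b) = inner ℝ g (mulVec3 A b) := by
  rw [peachKoehler, inner_cross_cross, real_inner_self_eq_norm_sq, hτ, real_inner_comm τ g, hτg]
  ring

lemma norm_cross_of_orthonormal {τ g : E3} (hτ : ‖τ‖ = 1) (hg : ‖g‖ = 1)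
    (hτg : inner ℝ τ g = 0) : ‖cross τ g‖ = 1 := by
  have h : ‖cross τ g‖ ^ 2 = 1 := by
    rw [← real_inner_self_eq_norm_sq, inner_cross_cross, real_inner_self_eq_norm_sq,
      real_inner_self_eq_norm_sq, hτ, hg, hτg]
    ring
  nlinarith [norm_nonneg (cross τ g)]

lemma cross_cross_self_of_orthogonal {τ w : E3} (hτ : ‖τ‖ = 1) (h : inner ℝ τ w = 0) :
    cross τ (cross τ w) = -w := by
  rw [cross_cross, h, real_inner_self_eq_norm_sq, hτ]; simp

/-- The vectors `τ`, `g`, `τ × g` are orthonormal and `b` has no `g` component. In the proof, `a ×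
(b × a)` with `a = τ × g` is computed in two ways. -/
lemma projNormal_eq_smul_cross {τ g b : E3} (hτ : ‖τ‖ = 1) (hg : ‖g‖ = 1)
    (hτg : inner ℝ τ g = 0) (hbg : inner ℝ b g = 0) :
    projNormal τ b = inner ℝ (cross τ g) b • cross τ g := by
  have h1 : cross b (cross τ g) = -(inner ℝ τ b • g) := by
    rw [cross_cross, hbg, real_inner_comm]; simp
  have h2 : cross (cross τ g) g = -τ := by
    rw [cross_anticomm, cross_cross, real_inner_self_eq_norm_sq, hg, real_inner_comm, hτg]; simp
  have h3 := cross_cross (cross τ g) b (cross τ g)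
  rw [h1, ← neg_smul, cross_smul_right, h2, real_inner_self_eq_norm_sq,
    norm_cross_of_orthonormal hτ hg hτg] at h3
  simp only [smul_neg, neg_smul, neg_neg, one_pow, one_smul] at h3
  rw [projNormal, h3]; abel

lemma speedAlong_neg {f : ℝ → ℝ} (hf : ∀ r, f (-r) = -f r) (ν F : E3) :
    speedAlong f (-ν) F = speedAlong f ν F := by
  simp [speedAlong, inner_neg_left, hf]

lemma glideDir_eq_or {τ g b : E3} (hτ : ‖τ‖ = 1) (hg : ‖g‖ = 1)
    (hτg : inner ℝ τ g = 0) (hbg : inner ℝ b g = 0) :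
    glideDir g τ b = cross τ g ∨ glideDir g τ b = -cross τ g := by
  unfold glideDir
  split_ifs with h
  · exact Or.inl rfl
  · have hp := projNormal_eq_smul_cross hτ hg hτg hbg
    have hc : inner ℝ (cross τ g) b ≠ 0 := fun h0 => h (by rw [hp, h0, zero_smul])
    rw [bPerp, hp, norm_smul, norm_cross_of_orthonormal hτ hg hτg, mul_one, smul_smul,
      Real.norm_eq_abs]
    rcases lt_or_gt_of_ne hc with h1 | h1
    · right; rw [abs_of_neg h1, inv_neg, neg_mul, inv_mul_cancel₀ hc, neg_one_smul]
    · left; rw [abs_of_pos h1, inv_mul_cancel₀ hc, one_smul]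

/-- Oddness of `f` removes the sign of the glide direction, and the triple product rule removes `τ`
from the argument of `f`. This gives one formula for screw and non-screw points. -/
lemma speedAlong_glideDir {f : ℝ → ℝ} (hf : ∀ r, f (-r) = -f r) {τ g b : E3} (hτ : ‖τ‖ = 1)
    (hg : ‖g‖ = 1) (hτg : inner ℝ τ g = 0) (hbg : inner ℝ b g = 0)
    (A : Matrix (Fin 3) (Fin 3) ℝ) :
    speedAlong f (glideDir g τ b) (peachKoehler A τ b) =
      f (inner ℝ g (mulVec3 A b)) • cross τ g := by
  have h : speedAlong f (cross τ g) (peachKoehler A τ b) =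
      f (inner ℝ g (mulVec3 A b)) • cross τ g := by
    rw [speedAlong, inner_cross_peachKoehler hτ hτg]
  rcases glideDir_eq_or hτ hg hτg hbg with h1 | h1
  · rw [h1, h]
  · rw [h1, speedAlong_neg hf, h]

/-- On the orthogonal space of `τ`, the maps `w ↦ w × τ` and `w ↦ τ × w` are inverse to each other,
and the tangential part of `u` does not contribute to `u × τ`. -/
lemma cross_smul_sub_eq_zero_iff {τ g u : E3} (hτ : ‖τ‖ = 1) (hτg : inner ℝ τ g = 0)
    {r : ℝ} (hr : r ≠ 0) (k : ℝ) :
    cross u (r • τ) - (k * r) • g = 0 ↔ projNormal τ u = k • cross τ g := by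
  have h0 : cross u (r • τ) - (k * r) • g = r • (cross u τ - k • g) := by
    rw [cross_smul_right, smul_sub, smul_smul, mul_comm]
  have h1 : cross τ (cross u τ) = projNormal τ u := by
    rw [cross_cross, real_inner_self_eq_norm_sq, hτ, projNormal]; simp
  have h2 : cross (projNormal τ u) τ = cross u τ := by
    rw [projNormal, cross_sub_left, cross_smul_left, cross_self]; simp
  rw [h0, smul_eq_zero_iff_right hr, sub_eq_zero]
  constructor
  · intro h
    rw [← h1, h, cross_smul_right]
  · intro h
    rw [← h2, h, cross_smul_left, cross_anticomm, cross_cross_self_of_orthogonal hτ hτg, neg_neg]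

lemma continuous_rot {ψ : E3 → E3} (hψ : ContDiff ℝ 1 ψ) : Continuous (rot ψ) := by
  have h : ∀ i j, Continuous (partialDeriv i j ψ) := fun i j => by
    have h1 : Continuous (fun x => fderiv ℝ ψ x (EuclideanSpace.single i 1)) :=
      (hψ.continuous_fderiv (by norm_num)).clm_apply continuous_const
    exact (EuclideanSpace.proj (𝕜 := ℝ) j).continuous.comp h1
  refine (PiLp.continuous_toLp 2 _).comp (continuous_pi fun i => ?_)
  fin_cases i
  · exact (h 1 2).sub (h 2 1)
  · exact (h 2 0).sub (h 0 2)
  · exact (h 0 1).sub (h 1 0)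

/-! ### Derivatives of the parametrization. -/

namespace MovingCurve
variable {Ω : Set E3} {Te : ℝ} (ℓ : MovingCurve Ω Te)

/-- The time derivative of the parametrization (one-sided at `t = 0`). -/
noncomputable def velocity (t s : ℝ) : E3 :=
  fderivWithin ℝ (fun p : ℝ × ℝ => ℓ.y p.1 p.2) (Ico 0 Te ×ˢ univ) (t, s) (1, 0)

lemma uniqueDiffOn (Te : ℝ) : UniqueDiffOn ℝ (Ico 0 Te ×ˢ (univ : Set ℝ)) :=
  (uniqueDiffOn_Ico 0 Te).prod uniqueDiffOn_univ

variable {t s : ℝ}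

lemma hasFDerivWithinAt (ht : t ∈ Ico 0 Te) :
    HasFDerivWithinAt (fun p : ℝ × ℝ => ℓ.y p.1 p.2)
      (fderivWithin ℝ (fun p : ℝ × ℝ => ℓ.y p.1 p.2) (Ico 0 Te ×ˢ univ) (t, s))
      (Ico 0 Te ×ˢ univ) (t, s) :=
  (ℓ.contDiffOn.differentiableOn (by norm_num) (t, s) ⟨ht, mem_univ _⟩).hasFDerivWithinAt

lemma hasDerivWithinAt_velocity (ht : t ∈ Ico 0 Te) :
    HasDerivWithinAt (fun r => ℓ.y r s) (ℓ.velocity t s) (Ico 0 Te) t := by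
  have h1 : HasDerivWithinAt (fun r : ℝ => (r, s)) ((1 : ℝ), (0 : ℝ)) (Ico 0 Te) t :=
    (hasDerivWithinAt_id t _).prodMk (hasDerivWithinAt_const t _ s)
  exact HasFDerivWithinAt.comp_hasDerivWithinAt (f := fun r : ℝ => (r, s)) t (ℓ.hasFDerivWithinAt ht) h1 (fun r hr => ⟨hr, mem_univ _⟩)

lemma hasDerivAt_param_aux (ht : t ∈ Ico 0 Te) :
    HasDerivAt (ℓ.y t)
      (fderivWithin ℝ (fun p : ℝ × ℝ => ℓ.y p.1 p.2) (Ico 0 Te ×ˢ univ) (t, s) (0, 1)) s := by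
  have h1 : HasDerivAt (fun r : ℝ => (t, r)) ((0 : ℝ), (1 : ℝ)) s :=
    (hasDerivAt_const s t).prodMk (hasDerivAt_id s)
  rw [← hasDerivWithinAt_univ] at h1 ⊢
  exact (ℓ.hasFDerivWithinAt ht).comp_hasDerivWithinAt s h1 (fun r hr => ⟨ht, mem_univ _⟩)

lemma fderivWithin_zero_one (ht : t ∈ Ico 0 Te) :
    fderivWithin ℝ (fun p : ℝ × ℝ => ℓ.y p.1 p.2) (Ico 0 Te ×ˢ univ) (t, s) (0, 1) =
      deriv (ℓ.y t) s :=
  (ℓ.hasDerivAt_param_aux ht).deriv.symm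

lemma hasDerivAt_param (ht : t ∈ Ico 0 Te) : HasDerivAt (ℓ.y t) (deriv (ℓ.y t) s) s :=
  (ℓ.hasDerivAt_param_aux ht).differentiableAt.hasDerivAt

lemma fderivWithin_apply (ht : t ∈ Ico 0 Te) (p : ℝ × ℝ) :
    fderivWithin ℝ (fun p : ℝ × ℝ => ℓ.y p.1 p.2) (Ico 0 Te ×ˢ univ) (t, s) p =
      p.1 • ℓ.velocity t s + p.2 • deriv (ℓ.y t) s := by
  rw [← ℓ.fderivWithin_zero_one ht, velocity, ← map_smul, ← map_smul, ← map_add]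
  simp

lemma continuousOn_param :
    ContinuousOn (fun p : ℝ × ℝ => ℓ.y p.1 p.2) (Ico 0 Te ×ˢ univ) :=
  ℓ.contDiffOn.continuousOn

lemma continuousOn_fderivWithin : ContinuousOn
    (fderivWithin ℝ (fun p : ℝ × ℝ => ℓ.y p.1 p.2) (Ico 0 Te ×ˢ univ)) (Ico 0 Te ×ˢ univ) :=
  ℓ.contDiffOn.continuousOn_fderivWithin (uniqueDiffOn Te) (by norm_num)

lemma continuousOn_velocity :
    ContinuousOn (fun p : ℝ × ℝ => ℓ.velocity p.1 p.2) (Ico 0 Te ×ˢ univ) :=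
  ℓ.continuousOn_fderivWithin.clm_apply continuousOn_const

lemma continuousOn_deriv :
    ContinuousOn (fun p : ℝ × ℝ => deriv (ℓ.y p.1) p.2) (Ico 0 Te ×ˢ univ) := by
  have h : ContinuousOn (fun p : ℝ × ℝ => fderivWithin ℝ (fun p : ℝ × ℝ => ℓ.y p.1 p.2)
      (Ico 0 Te ×ˢ univ) p (0, 1)) (Ico 0 Te ×ˢ univ) :=
    ℓ.continuousOn_fderivWithin.clm_apply continuousOn_const
  exact h.congr fun p hp => (ℓ.fderivWithin_zero_one hp.1).symm

lemma continuous_y (ht : t ∈ Ico 0 Te) : Continuous (ℓ.y t) :=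
  continuous_iff_continuousAt.2 fun _ => (ℓ.hasDerivAt_param ht).continuousAt

lemma continuous_deriv_y (ht : t ∈ Ico 0 Te) : Continuous (deriv (ℓ.y t)) := by
  rw [← continuousOn_univ]
  exact ℓ.continuousOn_deriv.comp (f := fun s => (t, s)) (by fun_prop) (fun s _ => ⟨ht, mem_univ _⟩)

lemma norm_deriv_pos (ht : t ∈ Ico 0 Te) : 0 < ‖deriv (ℓ.y t) s‖ :=
  norm_pos_iff.2 (ℓ.regular t ht s)

lemma norm_tangent (ht : t ∈ Ico 0 Te) : ‖ℓ.tangent t s‖ = 1 := by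
  rw [tangent, norm_smul, norm_inv, norm_norm, inv_mul_cancel₀ (ℓ.norm_deriv_pos ht).ne']

lemma norm_smul_tangent (ht : t ∈ Ico 0 Te) :
    ‖deriv (ℓ.y t) s‖ • ℓ.tangent t s = deriv (ℓ.y t) s := by
  rw [tangent, smul_smul, mul_inv_cancel₀ (ℓ.norm_deriv_pos ht).ne', one_smul]

lemma inner_deriv_eq_zero (g : E3)
    (hplane : ∀ t ∈ Ico 0 Te, ∃ c : ℝ, ∀ x ∈ ℓ.curve t, inner ℝ g x = c) (ht : t ∈ Ico 0 Te) :
    inner ℝ g (deriv (ℓ.y t) s) = 0 := by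
  obtain ⟨c, hc⟩ := hplane t ht
  have h1 : HasDerivAt (fun r => inner ℝ g (ℓ.y t r)) (inner ℝ g (deriv (ℓ.y t) s)) s := by
    simpa using (hasDerivAt_const s g).inner ℝ (ℓ.hasDerivAt_param ht (s := s))
  have h2 : (fun r => inner ℝ g (ℓ.y t r)) = fun _ => c := funext fun r => hc _ ⟨r, rfl⟩
  rw [h2] at h1
  exact h1.unique (hasDerivAt_const s c)

/-! ### Parameter windows, which treat closed and open curves alike. -/

/-- A parameter interval around `s₀` that sees, at the times in `J`, the part of the curve in `K`
exactly once. -/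
structure Window (s₀ : ℝ) (K : Set E3) (J : Set ℝ) (α β : ℝ) : Prop where
  left_lt : α < s₀
  lt_right : s₀ < β
  exists_mem : ∀ t ∈ J, ∀ s, ℓ.y t s ∈ K → ∃ s' ∈ Icc α β, ℓ.y t s' = ℓ.y t s
  eq_of_eq : ∀ t ∈ Ico 0 Te, ∀ s ∈ Icc α β, ℓ.y t s = ℓ.y t s₀ → s = s₀
  integral_eq : ∀ t ∈ J, ∀ G : ℝ → ℝ, (∀ s, ℓ.y t s ∉ K → G s = 0) →
    (∀ L, Function.Periodic (ℓ.y t) L → Function.Periodic G L) →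
    ∫ s in ℓ.dom, G s = ∫ s in α..β, G s
  boundary : (∀ t ∈ Ico 0 Te, ℓ.y t α = ℓ.y t β) ∨ (∀ t ∈ J, ℓ.y t α ∉ K ∧ ℓ.y t β ∉ K)

/-- For a closed curve the window is one period centred at `s₀`: a second parameter of the same
point would differ from `s₀` by a nonzero multiple of `L`, but the window allows only `L / 2`. For
an open curve the parameters that meet `K` during `J` are bounded, and any larger interval will do.
-/
lemma exists_window (s₀ : ℝ) {K : Set E3} (hK : IsCompact K) (hKΩ : K ⊆ Ω) {J : Set ℝ}
    (hJ : IsCompact J) (hJT : J ⊆ Ico 0 Te) : ∃ α β, ℓ.Window s₀ K J α β := by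
  rcases ℓ.closed_or_open with ⟨L, hL, hdom, hper⟩ | ⟨hdom, hprop⟩
  · refine ⟨s₀ - L / 2, s₀ + L / 2, by linarith, by linarith, ?_, ?_, ?_, ?_⟩
    · intro t ht s _
      obtain ⟨s', hs', h⟩ := (hper t (hJT ht)).exists_mem_Ico hL s (s₀ - L / 2)
      refine ⟨s', ⟨hs'.1, ?_⟩, h.symm⟩
      have := hs'.2; linarith
    · intro t ht s hs h
      have hinj := ℓ.injOn t ht
      rw [hdom] at hinj
      -- compare the representatives in the period `(0, L]`
      have e1 : ℓ.y t (toIocMod hL 0 s) = ℓ.y t s :=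
        (hper t ht).sub_zsmul_eq _
      have e2 : ℓ.y t (toIocMod hL 0 s₀) = ℓ.y t s₀ :=
        (hper t ht).sub_zsmul_eq _
      have h3 : toIocMod hL 0 s = toIocMod hL 0 s₀ := by
        apply hinj _ _ (by rw [e1, e2, h])
        · simpa using toIocMod_mem_Ioc hL 0 s
        · simpa using toIocMod_mem_Ioc hL 0 s₀
      rw [← self_sub_toIocDiv_zsmul, ← self_sub_toIocDiv_zsmul] at h3
      set m := toIocDiv hL 0 s
      set n := toIocDiv hL 0 s₀
      have h4 : s - s₀ = ((m - n : ℤ) : ℝ) * L := by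
        simp only [zsmul_eq_mul] at h3; push_cast; linarith
      have h5 : |((m - n : ℤ) : ℝ)| < 1 := by
        have : |s - s₀| ≤ L / 2 := abs_le.2 ⟨by linarith [hs.1], by linarith [hs.2]⟩
        rw [h4, abs_mul, abs_of_pos hL] at this
        by_contra hc
        push Not at hc
        nlinarith
      have h6 : m - n = 0 := by
        rw [← Int.abs_lt_one_iff]; exact_mod_cast h5
      rw [h6] at h4
      simp at h4
      linarith
    · intro t ht G _ hG
      rw [hdom, ← intervalIntegral.integral_of_le hL.le]
      have := (hG L (hper t (hJT ht))).intervalIntegral_add_eq 0 (s₀ - L / 2)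
      rw [zero_add] at this
      rw [this]; congr 1; ring
    · left
      intro t ht
      have := hper t ht (s₀ - L / 2)
      rw [← this]; congr 1; ring
  · obtain ⟨R, hR⟩ := (hprop K hK hKΩ J hJ hJT).subset_closedBall 0
    have hR' : ∀ t ∈ J, ∀ s, ℓ.y t s ∈ K → |s| ≤ R := fun t ht s hs => by
      simpa using hR ⟨t, ht, hs⟩
    -- The margins of 1 put `s₀` in the interior and make the end points of the window miss `K`.
    refine ⟨min (-R - 1) (s₀ - 1), max (R + 1) (s₀ + 1), ?_, ?_, ?_, ?_, ?_, ?_⟩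
    · exact (min_le_right _ _).trans_lt (by linarith)
    · exact lt_of_lt_of_le (by linarith) (le_max_right _ _)
    · intro t ht s hs
      have := abs_le.1 (hR' t ht s hs)
      exact ⟨s, ⟨(min_le_left _ _).trans (by linarith), le_trans (by linarith) (le_max_left _ _)⟩,
        rfl⟩
    · intro t ht s _ h
      have hinj := ℓ.injOn t ht
      rw [hdom] at hinj
      exact hinj (mem_univ _) (mem_univ _) h
    · intro t ht G hG _
      rw [hdom, setIntegral_univ, intervalIntegral.integral_eq_integral_of_support_subset]
      intro s hs
      have := abs_le.1 (hR' t ht s (by_contra fun h => hs (hG s h)))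
      exact ⟨(min_le_left _ _).trans_lt (by linarith),
        le_trans (by linarith) (le_max_left _ _)⟩
    · right
      intro t ht
      refine ⟨fun h => ?_, fun h => ?_⟩
      · have := (abs_le.1 (hR' t ht _ h)).1
        linarith [min_le_left (-R - 1) (s₀ - 1)]
      · have := (abs_le.1 (hR' t ht _ h)).2
        linarith [le_max_left (R + 1) (s₀ + 1)]

end MovingCurve
-- The normal velocity as the normal part of the parametric velocity.
/-- A selection that tends to a point, from solutions that exist arbitrarily near to it. -/
lemma exists_tendsto_selection {D : Set ℝ} {t₀ s₀ : ℝ} {P : ℝ → ℝ → Prop} (h₀ : P t₀ s₀)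
    (hP : ∀ δ > 0, ∀ᶠ t in 𝓝[D] t₀, ∃ s, |s - s₀| ≤ δ ∧ P t s) :
    ∃ σ : ℝ → ℝ, σ t₀ = s₀ ∧ Tendsto σ (𝓝[D] t₀) (𝓝 s₀) ∧ ∀ᶠ t in 𝓝[D] t₀, P t (σ t) := by
  classical
  let d : ℝ → ℝ := fun t => sInf ((fun s => |s - s₀|) '' {s | P t s})
  have hbdd : ∀ t, BddBelow ((fun s => |s - s₀|) '' {s | P t s}) := fun t =>
    ⟨0, by rintro _ ⟨s, -, rfl⟩; exact abs_nonneg _⟩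
  -- The infimum `d t` need not be attained. The slack `|t - t₀|` is positive for `t ≠ t₀` and
  -- disappears in the limit.
  have hsel : ∀ t, ∃ s, (t = t₀ → s = s₀) ∧
      ((∃ s', P t s') → P t s ∧ |s - s₀| ≤ d t + |t - t₀|) := by
    intro t
    rcases eq_or_ne t t₀ with rfl | ht
    · refine ⟨s₀, fun _ => rfl, fun _ => ⟨h₀, ?_⟩⟩
      have : 0 ≤ d t := Real.sInf_nonneg (by rintro _ ⟨s, -, rfl⟩; exact abs_nonneg _)
      simpa using this
    · by_cases he : ∃ s', P t s'
      · obtain ⟨s', hs'⟩ := he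
        obtain ⟨_, ⟨s, hs, rfl⟩, hlt⟩ := Real.lt_sInf_add_pos
          (s := (fun s => |s - s₀|) '' {s | P t s}) ⟨_, s', hs', rfl⟩
          (abs_pos.2 (sub_ne_zero.2 ht))
        exact ⟨s, fun h => (ht h).elim, fun _ => ⟨hs, hlt.le⟩⟩
      · exact ⟨s₀, fun _ => rfl, fun h => (he h).elim⟩
  choose σ hσ₀ hσ using hsel
  refine ⟨σ, hσ₀ t₀ rfl, ?_, ?_⟩
  · rw [Metric.tendsto_nhds]
    intro ε hε
    have h1 : ∀ᶠ t in 𝓝[D] t₀, |t - t₀| < ε / 2 := by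
      have : Tendsto (fun t => |t - t₀|) (𝓝[D] t₀) (𝓝 0) := by
        have : ContinuousAt (fun t => |t - t₀|) t₀ := by fun_prop
        simpa using this.tendsto.mono_left nhdsWithin_le_nhds
      exact this.eventually_lt_const (half_pos hε)
    filter_upwards [h1, hP (ε / 2) (half_pos hε)] with t ht1 ⟨s, hs, hPs⟩
    have h2 : d t ≤ ε / 2 := (csInf_le (hbdd t) ⟨s, hPs, rfl⟩).trans hs
    rw [Real.dist_eq]
    linarith [(hσ t ⟨s, hPs⟩).2]
  · filter_upwards [hP 1 one_pos] with t ⟨s, _, hPs⟩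
    exact (hσ t ⟨s, hPs⟩).1

namespace MovingCurve
variable {Ω : Set E3} {Te : ℝ} (ℓ : MovingCurve Ω Te) {t₀ s₀ : ℝ}

/-- The points of the curve on a fixed normal plane move with the normal part of the velocity of
the parametrization. -/
lemma hasDerivWithinAt_of_normal (ht₀ : t₀ ∈ Ico 0 Te) {σ : ℝ → ℝ} (hσ₀ : σ t₀ = s₀)
    (hσ : Tendsto σ (𝓝[Ico 0 Te] t₀) (𝓝 s₀))
    (hn : ∀ᶠ t in 𝓝[Ico 0 Te] t₀,
      inner ℝ (ℓ.y t (σ t) - ℓ.y t₀ s₀) (ℓ.tangent t₀ s₀) = 0) :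
    HasDerivWithinAt (fun t => ℓ.y t (σ t))
      (projNormal (ℓ.tangent t₀ s₀) (ℓ.velocity t₀ s₀)) (Ico 0 Te) t₀ := by
  set τ := ℓ.tangent t₀ s₀ with hτdef
  set u := ℓ.velocity t₀ s₀
  set r := ‖deriv (ℓ.y t₀) s₀‖ with hr
  have hr0 : 0 < r := ℓ.norm_deriv_pos ht₀
  have hτ : ‖τ‖ = 1 := ℓ.norm_tangent ht₀
  have hw : deriv (ℓ.y t₀) s₀ = r • τ := (ℓ.norm_smul_tangent ht₀).symm
  set l := 𝓝[Ico 0 Te] t₀ with hl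
  have hmem : ∀ᶠ t in l, t ∈ Ico 0 Te := self_mem_nhdsWithin
  have hpair : Tendsto (fun t => (t, σ t)) l (𝓝[Ico 0 Te ×ˢ univ] (t₀, s₀)) := by
    refine tendsto_nhdsWithin_iff.2 ⟨?_, hmem.mono fun t ht => ⟨ht, mem_univ _⟩⟩
    rw [nhds_prod_eq]
    exact (tendsto_id.mono_left nhdsWithin_le_nhds).prodMk hσ
  let e : ℝ → E3 := fun t => ℓ.y t (σ t) - ℓ.y t₀ s₀ - ((t - t₀) • u + (σ t - s₀) • (r • τ))
  have he : e =o[l] fun t => ((t - t₀, σ t - s₀) : ℝ × ℝ) := by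
    have h := (hasFDerivWithinAt_iff_isLittleO.1
      (ℓ.hasFDerivWithinAt (t := t₀) (s := s₀) ht₀)).comp_tendsto hpair
    refine (h.congr_left ?_)
    intro t
    simp only [Function.comp, ℓ.fderivWithin_apply ht₀, hw]
    rfl
  have hin : ∀ᶠ t in l, (t - t₀) * inner ℝ τ u + (σ t - s₀) * r + inner ℝ τ (e t) = 0 := by
    filter_upwards [hn] with t ht
    have h1 : ℓ.y t (σ t) - ℓ.y t₀ s₀ = ((t - t₀) • u + (σ t - s₀) • (r • τ)) + e t := by
      simp only [e]; abel
    rw [h1, real_inner_comm, inner_add_right, inner_add_right, inner_smul_right, inner_smul_right,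
      inner_smul_right, real_inner_self_eq_norm_sq, hτ] at ht
    linarith
  -- Convergence of `σ` improves to a Lipschitz bound at `t₀`: solve the plane condition for `(σ t -
  -- s₀) r` and absorb the part of the remainder, at most `r / 2 · |σ t - s₀|`, on the left.
  have hO : (fun t => σ t - s₀) =O[l] fun t => t - t₀ := by
    refine Asymptotics.IsBigO.of_bound (2 * ‖u‖ / r + 1) ?_
    filter_upwards [hin, he.bound (half_pos hr0)] with t h1 h2
    rw [Real.norm_eq_abs, Real.norm_eq_abs]
    have h3 : ‖((t - t₀, σ t - s₀) : ℝ × ℝ)‖ ≤ |t - t₀| + |σ t - s₀| := by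
      rw [Prod.norm_def, Real.norm_eq_abs, Real.norm_eq_abs]
      exact max_le (by linarith [abs_nonneg (σ t - s₀)]) (by linarith [abs_nonneg (t - t₀)])
    have h4 : |inner ℝ τ (e t)| ≤ ‖e t‖ := by
      have := abs_real_inner_le_norm τ (e t); rwa [hτ, one_mul] at this
    have h5 : |inner ℝ τ u| ≤ ‖u‖ := by
      have := abs_real_inner_le_norm τ u; rwa [hτ, one_mul] at this
    have h6 : |σ t - s₀| * r ≤ |t - t₀| * ‖u‖ + ‖e t‖ := by
      have : (σ t - s₀) * r = -((t - t₀) * inner ℝ τ u + inner ℝ τ (e t)) := by linarith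
      calc |σ t - s₀| * r = |(σ t - s₀) * r| := by rw [abs_mul, abs_of_pos hr0]
        _ ≤ |(t - t₀) * inner ℝ τ u| + |inner ℝ τ (e t)| := by
            rw [this, abs_neg]; exact abs_add_le _ _
        _ ≤ _ := by rw [abs_mul]; gcongr
    have h7 : ‖e t‖ ≤ r / 2 * (|t - t₀| + |σ t - s₀|) := h2.trans (by gcongr)
    have h8 : |σ t - s₀| * r ≤ (2 * ‖u‖ + r) * |t - t₀| := by nlinarith
    calc |σ t - s₀| = |σ t - s₀| * r / r := by field_simp
      _ ≤ (2 * ‖u‖ + r) * |t - t₀| / r := by gcongr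
      _ = _ := by field_simp
  have hea : e =o[l] fun t => t - t₀ :=
    he.trans_isBigO ((Asymptotics.isBigO_refl _ _).prod_left hO)
  rw [hasDerivWithinAt_iff_isLittleO]
  -- The plane condition cancels the tangential displacement, so what remains besides `(t - t₀)`
  -- times the normal velocity is the normal part of `e`.
  have hτe : (fun t => inner ℝ τ (e t) • τ) =o[l] fun t => t - t₀ := by
    refine Asymptotics.IsBigO.trans_isLittleO (Asymptotics.IsBigO.of_bound 1 ?_) hea
    refine Eventually.of_forall fun t => ?_
    rw [norm_smul, hτ, mul_one, one_mul, Real.norm_eq_abs]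
    have := abs_real_inner_le_norm τ (e t); rwa [hτ, one_mul] at this
  refine (hea.sub hτe).congr' ?_ EventuallyEq.rfl
  filter_upwards [hin] with t ht
  have h1 : inner ℝ τ (e t) = -((t - t₀) * inner ℝ τ u + (σ t - s₀) * r) := by linarith
  rw [h1, hσ₀]
  simp only [e, projNormal, smul_sub, smul_smul, add_smul, neg_smul]
  abel

/-- At time `t₀` the signed distance to the normal plane has derivative `|∂ₛy| > 0` at `s₀`, so it
has opposite signs at `s₀ ± η`. The signs persist for nearby times, and the intermediate value
theorem gives an intersection in between. -/
lemma exists_normal_selection (ht₀ : t₀ ∈ Ico 0 Te) : ∃ σ : ℝ → ℝ, σ t₀ = s₀ ∧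
    Tendsto σ (𝓝[Ico 0 Te] t₀) (𝓝 s₀) ∧ ∀ᶠ t in 𝓝[Ico 0 Te] t₀,
      inner ℝ (ℓ.y t (σ t) - ℓ.y t₀ s₀) (ℓ.tangent t₀ s₀) = 0 := by
  set τ := ℓ.tangent t₀ s₀ with hτdef
  have hr0 : 0 < ‖deriv (ℓ.y t₀) s₀‖ := ℓ.norm_deriv_pos ht₀
  have hτ : ‖τ‖ = 1 := ℓ.norm_tangent ht₀
  refine exists_tendsto_selection
    (P := fun t s => inner ℝ (ℓ.y t s - ℓ.y t₀ s₀) τ = 0) (by simp) fun δ hδ => ?_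
  let h : ℝ → ℝ → ℝ := fun t s => inner ℝ (ℓ.y t s - ℓ.y t₀ s₀) τ
  have hd : HasDerivAt (h t₀) ‖deriv (ℓ.y t₀) s₀‖ s₀ := by
    have h1 := ((ℓ.hasDerivAt_param (s := s₀) ht₀).sub_const (ℓ.y t₀ s₀)).inner ℝ
      (hasDerivAt_const s₀ τ)
    have h2 : inner ℝ (deriv (ℓ.y t₀) s₀) τ = ‖deriv (ℓ.y t₀) s₀‖ := by
      rw [← ℓ.norm_smul_tangent ht₀, inner_smul_left, real_inner_self_eq_norm_sq, ← hτdef,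
        norm_smul, hτ]
      simp
    simpa [h2] using h1
  have hs : ∀ᶠ s in 𝓝[≠] s₀, 0 < slope (h t₀) s₀ s :=
    (hasDerivAt_iff_tendsto_slope.1 hd).eventually (lt_mem_nhds hr0)
  rw [eventually_nhdsWithin_iff, Metric.eventually_nhds_iff] at hs
  obtain ⟨ε, hε, hs⟩ := hs
  have hh0 : h t₀ s₀ = 0 := by simp [h]
  set η := min δ (ε / 2) with hη
  have hη0 : 0 < η := lt_min hδ (half_pos hε)
  have hηε : η < ε := (min_le_right _ _).trans_lt (by linarith)
  have hpos : 0 < h t₀ (s₀ + η) := by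
    have := hs (y := s₀ + η) (by rw [Real.dist_eq]; simpa [abs_of_pos hη0] using hηε)
      (by simp [hη0.ne'])
    rw [slope_def_field, hh0, add_sub_cancel_left, sub_zero] at this
    exact (div_pos_iff_of_pos_right hη0).1 this
  have hneg : h t₀ (s₀ - η) < 0 := by
    have := hs (y := s₀ - η) (by rw [Real.dist_eq]; simpa [abs_of_pos hη0] using hηε)
      (by simp [hη0.ne'])
    rw [slope_def_field, hh0, sub_sub_cancel_left, sub_zero, div_neg, neg_pos] at this
    by_contra hc
    exact absurd (div_nonneg (not_lt.1 hc) hη0.le) (not_le.2 this)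
  have hcont : ∀ s, ContinuousWithinAt (fun t => h t s) (Ico 0 Te) t₀ := fun s =>
    ((ℓ.hasDerivWithinAt_velocity (s := s) ht₀).continuousWithinAt.sub
      continuousWithinAt_const).inner continuousWithinAt_const
  filter_upwards [self_mem_nhdsWithin, (hcont (s₀ + η)).eventually (lt_mem_nhds hpos),
    (hcont (s₀ - η)).eventually (gt_mem_nhds hneg)] with t ht h1 h2
  have hc : ContinuousOn (h t) (Icc (s₀ - η) (s₀ + η)) :=
    (((ℓ.continuous_y ht).sub continuous_const).inner continuous_const).continuousOn
  obtain ⟨s, hs1, hs2⟩ := intermediate_value_Icc (by linarith) hc ⟨h2.le, h1.le⟩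
  refine ⟨s, ?_, hs2⟩
  rw [abs_le]
  have := min_le_left δ (ε / 2)
  exact ⟨by linarith [hs1.1], by linarith [hs1.2]⟩

/-- By compactness of the window it is enough to identify cluster points of `σ`. Each is a parameter
of `ℓ.y t₀ s₀` at time `t₀`, hence equals `s₀`: no other branch of the curve can supply the nearby
points. -/
lemma Window.tendsto {K : Set E3} {J : Set ℝ} {α β : ℝ} (W : ℓ.Window s₀ K J α β)
    (ht₀ : t₀ ∈ Ico 0 Te) {σ : ℝ → ℝ} (hσ : ∀ᶠ t in 𝓝[Ico 0 Te] t₀, σ t ∈ Icc α β)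
    (hy : Tendsto (fun t => ℓ.y t (σ t)) (𝓝[Ico 0 Te] t₀) (𝓝 (ℓ.y t₀ s₀))) :
    Tendsto σ (𝓝[Ico 0 Te] t₀) (𝓝 s₀) := by
  refine isCompact_Icc.tendsto_nhds_of_unique_mapClusterPt hσ fun s hs hcl => ?_
  obtain ⟨U, hU, hUs⟩ := mapClusterPt_iff_ultrafilter.1 hcl
  refine W.eq_of_eq t₀ ht₀ s hs ?_
  have hpair : Tendsto (fun t => (t, σ t)) U (𝓝[Ico 0 Te ×ˢ univ] (t₀, s)) := by
    refine tendsto_nhdsWithin_iff.2 ⟨?_, ?_⟩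
    · rw [nhds_prod_eq]
      exact (tendsto_id.mono_left (hU.trans nhdsWithin_le_nhds)).prodMk hUs
    · have hmem : ∀ᶠ t in (U : Filter ℝ), t ∈ Ico 0 Te := hU self_mem_nhdsWithin
      exact hmem.mono fun t ht => ⟨ht, mem_univ _⟩
  exact tendsto_nhds_unique ((ℓ.continuousOn_param (t₀, s) ⟨ht₀, mem_univ _⟩).tendsto.comp hpair)
    (hy.mono_left hU)

/-- The normal velocity is the normal part of the velocity of the parametrization. -/
lemma hasNormalVelocityAt_iff (hΩ : IsOpen Ω) (ht₀ : t₀ ∈ Ico 0 Te) (v : E3) :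
    ℓ.HasNormalVelocityAt t₀ s₀ v ↔
      projNormal (ℓ.tangent t₀ s₀) (ℓ.velocity t₀ s₀) = v := by
  constructor
  · rintro ⟨x, hx₀, hx, hv⟩
    obtain ⟨ε, hε, hεΩ⟩ := Metric.nhds_basis_closedBall.mem_iff.1
      (hΩ.mem_nhds (ℓ.mem t₀ ht₀ s₀))
    -- Windows need a compact time interval; `[0, T']` is one that contains all times of `[0, Te)`
    -- near `t₀`, including the case `t₀ = 0`.
    obtain ⟨T', hT1, hT2⟩ := exists_between ht₀.2
    obtain ⟨α, β, W⟩ := ℓ.exists_window s₀ (isCompact_closedBall (ℓ.y t₀ s₀) ε) hεΩ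
      (isCompact_Icc (a := 0) (b := T')) (fun t ht => ⟨ht.1, ht.2.trans_lt hT2⟩)
    have hxlim : Tendsto x (𝓝[Ico 0 Te] t₀) (𝓝 (ℓ.y t₀ s₀)) := hx₀ ▸ hv.continuousWithinAt
    have hex : ∀ᶠ t in 𝓝[Ico 0 Te] t₀, ∃ s ∈ Icc α β, ℓ.y t s = x t := by
      filter_upwards [self_mem_nhdsWithin, hx, hxlim (Metric.closedBall_mem_nhds _ hε),
        mem_nhdsWithin_of_mem_nhds (gt_mem_nhds hT1)] with t h1 h2 h3 h4
      obtain ⟨s, hs⟩ := h2.1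
      obtain ⟨s', hs', h⟩ := W.exists_mem t ⟨h1.1, h4.le⟩ s (hs ▸ h3)
      exact ⟨s', hs', h.trans hs⟩
    have hsel : ∀ t, ∃ s, (∃ s ∈ Icc α β, ℓ.y t s = x t) → s ∈ Icc α β ∧ ℓ.y t s = x t := by
      intro t
      by_cases h : ∃ s ∈ Icc α β, ℓ.y t s = x t
      · obtain ⟨s, hs⟩ := h; exact ⟨s, fun _ => hs⟩
      · exact ⟨0, fun h' => (h h').elim⟩
    choose σ hσ using hsel
    have hσe : ∀ᶠ t in 𝓝[Ico 0 Te] t₀, σ t ∈ Icc α β ∧ ℓ.y t (σ t) = x t :=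
      hex.mono fun t ht => hσ t ht
    have hσlim : Tendsto σ (𝓝[Ico 0 Te] t₀) (𝓝 s₀) :=
      Window.tendsto ℓ W ht₀ (hσe.mono fun t ht => ht.1)
        (hxlim.congr' (hσe.mono fun t ht => ht.2.symm))
    have hσ₀ : σ t₀ = s₀ := by
      have h := hσe.self_of_nhdsWithin ht₀
      exact W.eq_of_eq t₀ ht₀ _ h.1 (h.2.trans hx₀)
    have hd := ℓ.hasDerivWithinAt_of_normal ht₀ hσ₀ hσlim (by
      filter_upwards [hσe, hx] with t h1 h2
      rw [h1.2]; exact h2.2)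
    have hd' : HasDerivWithinAt x _ (Ico 0 Te) t₀ :=
      hd.congr_of_eventuallyEq (hσe.mono fun t ht => ht.2.symm) (by rw [hσ₀, hx₀])
    exact (uniqueDiffOn_Ico 0 Te t₀ ht₀).eq_deriv _ hd' hv
  · rintro rfl
    obtain ⟨σ, hσ₀, hσ, hn⟩ := ℓ.exists_normal_selection (s₀ := s₀) ht₀
    exact ⟨fun t => ℓ.y t (σ t), by simp only [hσ₀], hn.mono fun t ht => ⟨⟨σ t, rfl⟩, ht⟩,
      ℓ.hasDerivWithinAt_of_normal ht₀ hσ₀ hσ hn⟩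

end MovingCurve
-- Pairings as line integrals.
-- The direction field is arbitrary off the support, but the measure is concentrated on the support
-- within `Ω`, where the field is continuous.
lemma DislocationMeasure.aestronglyMeasurable_inner_dir {Ω : Set E3} (hΩ : IsOpen Ω)
    (ρ : DislocationMeasure Ω) {ψ : E3 → E3} (hψ : Continuous ψ) :
    AEStronglyMeasurable (fun x => inner ℝ (ρ.dir x) (ψ x)) ρ.total := by
  have h1 : MeasurableSet (ρ.total.support ∩ Ω) :=
    Measure.isClosed_support.measurableSet.inter hΩ.measurableSet
  have h2 : ρ.total.restrict (ρ.total.support ∩ Ω) = ρ.total :=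
    Measure.restrict_eq_self_of_ae_mem
      (inter_mem (Measure.support_mem_ae (μ := ρ.total)) (mem_ae_iff.2 ρ.total_compl))
  rw [← h2]
  exact (ρ.dir_continuousOn.inner hψ.continuousOn).aestronglyMeasurable h1

lemma DislocationMeasure.aestronglyMeasurable_inner_of_continuousOn {Ω : Set E3} (hΩ : IsOpen Ω)
    (ρ : DislocationMeasure Ω) {β ψ : E3 → E3} (hβ : ContinuousOn β Ω)
    (hψ : Continuous ψ) :
    AEStronglyMeasurable (fun x => inner ℝ (β x) (ψ x)) ρ.total := by
  have h2 : ρ.total.restrict Ω = ρ.total :=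
    Measure.restrict_eq_self_of_ae_mem (mem_ae_iff.2 ρ.total_compl)
  rw [← h2]
  exact (hβ.inner hψ.continuousOn).aestronglyMeasurable hΩ.measurableSet

namespace MovingCurve
variable {Ω : Set E3} {Te : ℝ} (ℓ : MovingCurve Ω Te) {t : ℝ} {b : E3}

lemma pairing_eq_setIntegral (ht : t ∈ Ico 0 Te) (hb : b ≠ 0) {ρ : DislocationMeasure Ω}
    (hρ : ℓ.IsDislocationMeasureOf b t ρ) {β ψ : E3 → E3}
    (hm : AEStronglyMeasurable (fun x => inner ℝ (β x) (ψ x)) ρ.total) :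
    pairing ρ.total β ψ =
      ‖b‖ * ∫ s in ℓ.dom, ‖deriv (ℓ.y t) s‖ * inner ℝ (β (ℓ.y t s)) (ψ (ℓ.y t s)) := by
  have hc : ENNReal.ofReal ‖b‖ ≠ 0 := by simpa using hb
  rw [hρ.1] at hm
  -- Because `b ≠ 0`, arc length is absolutely continuous with respect to its multiple by `|b|`.
  have hm' := hm.mono_ac (Measure.absolutelyContinuous_smul hc)
  have hmeas : Measurable fun s => ENNReal.ofReal ‖deriv (ℓ.y t) s‖ :=
    (ℓ.continuous_deriv_y ht).norm.measurable.ennreal_ofReal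
  rw [pairing, hρ.1, integral_smul_measure, ENNReal.toReal_ofReal (norm_nonneg _), smul_eq_mul,
    arcLength, integral_map (ℓ.continuous_y ht).aemeasurable hm',
    integral_withDensity_eq_integral_toReal_smul hmeas (by simp)]
  simp

/-- The pairing with the dislocation measure is a line integral over a parameter window. -/
lemma Window.pairing_dir_eq (hΩ : IsOpen Ω) (ht : t ∈ Ico 0 Te) (hb : b ≠ 0)
    {ρ : DislocationMeasure Ω} (hρ : ℓ.IsDislocationMeasureOf b t ρ) {s₀ α β : ℝ} {K : Set E3}
    {J : Set ℝ} (W : ℓ.Window s₀ K J α β) (htJ : t ∈ J) {ψ : E3 → E3} (hψ : Continuous ψ)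
    (hψK : ∀ x ∉ K, ψ x = 0) :
    pairing ρ.total ρ.dir ψ =
      ‖b‖ * ∫ s in α..β, inner ℝ (ψ (ℓ.y t s)) (deriv (ℓ.y t) s) := by
  rw [ℓ.pairing_eq_setIntegral ht hb hρ (ρ.aestronglyMeasurable_inner_dir hΩ hψ)]
  have h : ∀ s, ‖deriv (ℓ.y t) s‖ * inner ℝ (ρ.dir (ℓ.y t s)) (ψ (ℓ.y t s)) =
      inner ℝ (ψ (ℓ.y t s)) (deriv (ℓ.y t) s) := fun s => by
    rw [hρ.2 s, ← real_inner_smul_left, ℓ.norm_smul_tangent ht, real_inner_comm]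
  simp only [h]
  rw [W.integral_eq t htJ]
  · intro s hs; rw [hψK _ hs, inner_zero_left]
  · intro L hL s
    have hL' : Function.Periodic (deriv (ℓ.y t)) L := fun s => by
      have h1 : (fun s => ℓ.y t (s + L)) = ℓ.y t := funext hL
      rw [← deriv_comp_add_const, h1]
    simp only [hL s, hL' s]

lemma Window.pairing_normal_eq (hΩ : IsOpen Ω) (ht : t ∈ Ico 0 Te) (hb : b ≠ 0)
    {ρ : DislocationMeasure Ω} (hρ : ℓ.IsDislocationMeasureOf b t ρ) {s₀ α β : ℝ} {K : Set E3}
    {J : Set ℝ} (W : ℓ.Window s₀ K J α β) (htJ : t ∈ J) {ψ : E3 → E3} (hψ : Continuous ψ)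
    (hψK : ∀ x ∉ K, ψ x = 0) {k : E3 → ℝ} (hk : ContinuousOn k Ω) (g : E3) :
    pairing ρ.total (fun x => k x • g) ψ =
      ‖b‖ * ∫ s in α..β, inner ℝ (ψ (ℓ.y t s)) ((k (ℓ.y t s) * ‖deriv (ℓ.y t) s‖) • g) := by
  rw [ℓ.pairing_eq_setIntegral (β := fun x => k x • g) ht hb hρ (ρ.aestronglyMeasurable_inner_of_continuousOn hΩ
    (hk.smul continuousOn_const) hψ)]
  have h : ∀ s, ‖deriv (ℓ.y t) s‖ * inner ℝ (k (ℓ.y t s) • g) (ψ (ℓ.y t s)) =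
      inner ℝ (ψ (ℓ.y t s)) ((k (ℓ.y t s) * ‖deriv (ℓ.y t) s‖) • g) := fun s => by
    rw [real_inner_smul_left, real_inner_smul_right, real_inner_comm]; ring
  simp only [h]
  rw [W.integral_eq t htJ]
  · intro s hs; rw [hψK _ hs, inner_zero_left]
  · intro L hL s
    have hL' : Function.Periodic (deriv (ℓ.y t)) L := fun s => by
      have h1 : (fun s => ℓ.y t (s + L)) = ℓ.y t := funext hL
      rw [← deriv_comp_add_const, h1]
    simp only [hL s, hL' s]

end MovingCurve
-- Parameter integrals under weak regularity.
section Calculus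

variable {E : Type*} [NormedAddCommGroup E] [InnerProductSpace ℝ E]

/-- The difference quotient is `a t` paired with that of `d`, so `a` need only be continuous. In the
application `a` contains `∂ₛy`, which need not be differentiable in time. -/
lemma hasDerivAt_inner_of_eq_zero {a d : ℝ → E} {d' : E} {t₀ : ℝ} (ha : ContinuousAt a t₀)
    (hd : HasDerivAt d d' t₀) (h0 : d t₀ = 0) :
    HasDerivAt (fun t => inner ℝ (a t) (d t)) (inner ℝ (a t₀) d') t₀ := by
  rw [hasDerivAt_iff_tendsto_slope] at hd ⊢
  refine ((ha.tendsto.mono_left nhdsWithin_le_nhds).inner hd).congr fun t => ?_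
  simp [slope, h0, inner_smul_right]

lemma exists_lipschitz_bound {G G' : ℝ → ℝ → E} {a b α β t₀ : ℝ} (ht₀ : t₀ ∈ Icc a b)
    (hG : ∀ t ∈ Icc a b, ∀ s ∈ Icc α β, HasDerivAt (fun t => G t s) (G' t s) t)
    (hG' : ContinuousOn (fun p : ℝ × ℝ => G' p.1 p.2) (Icc a b ×ˢ Icc α β)) :
    ∃ C, ∀ t ∈ Icc a b, ∀ s ∈ Icc α β, ‖G t s - G t₀ s‖ ≤ C * |t - t₀| := by
  obtain ⟨C, hC⟩ := (isCompact_Icc.prod isCompact_Icc).exists_bound_of_continuousOn hG'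
  refine ⟨C, fun t ht s hs => ?_⟩
  exact (convex_Icc a b).norm_image_sub_le_of_norm_hasDerivWithin_le
    (fun r hr => (hG r hr s hs).hasDerivWithinAt) (fun r hr => hC (r, s) ⟨hr, hs⟩) ht₀ ht

/-- Dominated convergence, with a Lipschitz bound and a derivative at `t₀` only: the integrands in
use need not be differentiable at other times. -/
lemma hasDerivAt_intervalIntegral_of_bound {F : ℝ → ℝ → ℝ} {F' : ℝ → ℝ} {t₀ α β C : ℝ}
    (hαβ : α ≤ β) (hF : ∀ᶠ t in 𝓝 t₀, ContinuousOn (F t) (Icc α β))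
    (hF' : ContinuousOn F' (Icc α β))
    (hC : ∀ᶠ t in 𝓝 t₀, ∀ s ∈ Icc α β, |F t s - F t₀ s| ≤ C * |t - t₀|)
    (hd : ∀ s ∈ Icc α β, HasDerivAt (fun t => F t s) (F' s) t₀) :
    HasDerivAt (fun t => ∫ s in α..β, F t s) (∫ s in α..β, F' s) t₀ := by
  simp only [intervalIntegral.integral_of_le hαβ]
  have hsub := Ioc_subset_Icc_self (a := α) (b := β)
  have hint : ∀ {h : ℝ → ℝ}, ContinuousOn h (Icc α β) → Integrable h (volume.restrict (Ioc α β)) :=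
    fun hh => (hh.integrableOn_compact isCompact_Icc).mono_set hsub
  have h := (hasFDerivAt_integral_of_dominated_loc_of_lip' (𝕜 := ℝ)
    (μ := volume.restrict (Ioc α β)) (F := F) (x₀ := t₀) (bound := fun _ => C)
    (F' := fun s => (ContinuousLinearMap.toSpanSingleton ℝ (F' s)))
    (hF.and hC) (fun t ht => (hint ht.1).aestronglyMeasurable)
    (hint hF.self_of_nhds) ?_ ?_ (integrable_const C) ?_)
  · refine h.2.hasDerivAt.congr_deriv ?_
    rw [ContinuousLinearMap.integral_apply h.1]
    simp
  · exact (ContinuousLinearMap.toSpanSingletonCLE (𝕜 := ℝ) (E := ℝ)).continuous.comp_aestronglyMeasurable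
      (hint hF').aestronglyMeasurable
  · filter_upwards [ae_restrict_mem measurableSet_Ioc] with s hs t ht
    exact ht.2 s (hsub hs)
  · filter_upwards [ae_restrict_mem measurableSet_Ioc] with s hs
    exact (hd s (hsub hs)).hasFDerivAt

lemma continuousOn_intervalIntegral {h : ℝ → ℝ → ℝ} {c d α β : ℝ}
    (hh : ContinuousOn (fun p : ℝ × ℝ => h p.1 p.2) (Ioo c d ×ˢ univ)) :
    ContinuousOn (fun t => ∫ s in α..β, h t s) (Ioo c d) := by
  intro t₀ ht₀
  obtain ⟨a, ha1, ha2⟩ := exists_between ht₀.1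
  obtain ⟨b, hb1, hb2⟩ := exists_between ht₀.2
  have hab : a ≤ b := (ha2.trans hb1).le
  -- Clamping the time to `[a, b]` makes the integrand continuous on the whole plane without
  -- changing it near `t₀`.
  have hc : Continuous (fun t => ∫ s in α..β, h (projIcc a b hab t) s) := by
    apply intervalIntegral.continuous_parametric_intervalIntegral_of_continuous'
    refine hh.comp_continuous (f := fun p : ℝ × ℝ => ((projIcc a b hab p.1 : ℝ), p.2))
      (by fun_prop) fun p => ⟨?_, mem_univ _⟩
    have := (projIcc a b hab p.1).2
    exact ⟨ha1.trans_le this.1, this.2.trans_lt hb2⟩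
  refine (hc.continuousAt.congr ?_).continuousWithinAt
  filter_upwards [Ioo_mem_nhds ha2 hb1] with t ht
  rw [projIcc_of_mem hab (Ioo_subset_Icc_self ht)]

lemma integrableOn_of_continuousOn_of_eq_zero {h : ℝ → ℝ} {c d a b : ℝ} (hac : c < a) (hbd : b < d)
    (hh : ContinuousOn h (Ioo c d)) (h0 : ∀ t ∉ Ioo a b, h t = 0) : IntegrableOn h (Ioo c d) := by
  have h1 : IntegrableOn h (Icc a b) :=
    (hh.mono fun t ht => ⟨hac.trans_le ht.1, ht.2.trans_lt hbd⟩).integrableOn_compact isCompact_Icc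
  have h2 : Integrable h :=
    (integrableOn_iff_integrable_of_support_subset fun t ht =>
      Ioo_subset_Icc_self (by_contra fun hc => ht (h0 t hc))).1 h1
  exact h2.integrableOn

lemma exists_Ioo_of_isCompact {J : Set ℝ} (hJ : IsCompact J) {c d : ℝ} (hcd : c < d)
    (hJs : J ⊆ Ioo c d) : ∃ a b, c < a ∧ a < b ∧ b < d ∧ J ⊆ Ioo a b := by
  rcases J.eq_empty_or_nonempty with rfl | hne
  · obtain ⟨a, ha1, ha2⟩ := exists_between hcd
    obtain ⟨b, hb1, hb2⟩ := exists_between ha2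
    exact ⟨a, b, ha1, hb1, hb2, empty_subset _⟩
  · obtain ⟨m, hm, hm'⟩ := hJ.exists_isLeast hne
    obtain ⟨n, hn, hn'⟩ := hJ.exists_isGreatest hne
    obtain ⟨a, ha1, ha2⟩ := exists_between (hJs hm).1
    obtain ⟨b, hb1, hb2⟩ := exists_between (hJs hn).2
    exact ⟨a, b, ha1, (ha2.trans_le (hm' hn)).trans hb1, hb2,
      fun t ht => ⟨ha2.trans_le (hm' ht), (hn' ht).trans_lt hb1⟩⟩

end Calculus

/-! ### Space and time derivatives of test fields. -/

section TestFields

variable {φ : ℝ → E3 → E3}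

lemma hasFDerivAt_space (hφ : ContDiff ℝ 1 (fun p : ℝ × E3 => φ p.1 p.2)) (t : ℝ) (x : E3) :
    HasFDerivAt (φ t) ((fderiv ℝ (fun p : ℝ × E3 => φ p.1 p.2) (t, x)).comp
      (ContinuousLinearMap.inr ℝ ℝ E3)) x :=
  ((hφ.differentiable (by norm_num) (t, x)).hasFDerivAt).comp x
    (hasFDerivAt_prodMk_right t x)

lemma fderiv_space (hφ : ContDiff ℝ 1 (fun p : ℝ × E3 => φ p.1 p.2)) (t : ℝ) (x v : E3) :
    fderiv ℝ (φ t) x v = fderiv ℝ (fun p : ℝ × E3 => φ p.1 p.2) (t, x) (0, v) := by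
  rw [(hasFDerivAt_space hφ t x).fderiv]; rfl

lemma deriv_time (hφ : ContDiff ℝ 1 (fun p : ℝ × E3 => φ p.1 p.2)) (t : ℝ) (x : E3) :
    deriv (fun r => φ r x) t = fderiv ℝ (fun p : ℝ × E3 => φ p.1 p.2) (t, x) (1, 0) := by
  have h : HasFDerivAt (fun r => φ r x) ((fderiv ℝ (fun p : ℝ × E3 => φ p.1 p.2) (t, x)).comp
      (ContinuousLinearMap.inl ℝ ℝ E3)) t :=
    ((hφ.differentiable (by norm_num) (t, x)).hasFDerivAt).comp (f := fun r => (r, x)) t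
      (hasFDerivAt_prodMk_left t x)
  rw [h.hasDerivAt.deriv]; rfl

lemma continuous_deriv_time (hφ : ContDiff ℝ 1 (fun p : ℝ × E3 => φ p.1 p.2)) :
    Continuous (fun p : ℝ × E3 => deriv (fun r => φ r p.2) p.1) := by
  simp only [deriv_time hφ]
  exact (hφ.continuous_fderiv (by norm_num)).clm_apply continuous_const

lemma continuous_rot_space (hφ : ContDiff ℝ 1 (fun p : ℝ × E3 => φ p.1 p.2)) :
    Continuous (fun p : ℝ × E3 => rot (φ p.1) p.2) := by
  have h : ∀ i j, Continuous (fun p : ℝ × E3 => partialDeriv i j (φ p.1) p.2) := fun i j => by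
    simp only [partialDeriv, fderiv_space hφ]
    have h1 : Continuous (fun p : ℝ × E3 => fderiv ℝ (fun p : ℝ × E3 => φ p.1 p.2) p
        (0, EuclideanSpace.single i 1)) :=
      (hφ.continuous_fderiv (by norm_num)).clm_apply continuous_const
    exact (EuclideanSpace.proj (𝕜 := ℝ) j).continuous.comp h1
  refine (PiLp.continuous_toLp 2 _).comp (continuous_pi fun i => ?_)
  fin_cases i
  · exact (h 1 2).sub (h 2 1)
  · exact (h 2 0).sub (h 0 2)
  · exact (h 0 1).sub (h 1 0)

lemma fderiv_eq_zero_of_notMem (p : ℝ × E3) (hp : p ∉ tsupport (fun p : ℝ × E3 => φ p.1 p.2)) :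
    fderiv ℝ (fun p : ℝ × E3 => φ p.1 p.2) p = 0 := by
  by_contra h
  exact hp (support_fderiv_subset ℝ h)

lemma rot_eq_zero_of_notMem (hφ : ContDiff ℝ 1 (fun p : ℝ × E3 => φ p.1 p.2)) (t : ℝ) (x : E3)
    (hp : (t, x) ∉ tsupport (fun p : ℝ × E3 => φ p.1 p.2)) : rot (φ t) x = 0 := by
  apply e3_ext <;>
    simp [rot_zero, rot_one, rot_two, partialDeriv, fderiv_space hφ, fderiv_eq_zero_of_notMem _ hp]

end TestFields

/-! ### The transport formula. -/

namespace MovingCurve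
variable {Ω : Set E3} {Te : ℝ} (ℓ : MovingCurve Ω Te) {t₀ s₀ α β a b : ℝ} {K : Set E3}
  {φ : ℝ → E3 → E3}

/-- The derivative of the line integral of a test field along the moving curve. -/
lemma Window.hasDerivAt_lineIntegral (ht₀ : t₀ ∈ Ioo 0 Te)
    (W : ℓ.Window s₀ K (Icc a b) α β)
    (hφ : ContDiff ℝ 1 (fun p : ℝ × E3 => φ p.1 p.2))
    (hφK : ∀ t x, t ∉ Icc a b ∨ x ∉ K → φ t x = 0) :
    HasDerivAt (fun t => ∫ s in α..β, inner ℝ (φ t (ℓ.y t s)) (deriv (ℓ.y t) s))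
      (∫ s in α..β, (inner ℝ (deriv (fun r => φ r (ℓ.y t₀ s)) t₀) (deriv (ℓ.y t₀) s) +
        inner ℝ (rot (φ t₀) (ℓ.y t₀ s)) (cross (ℓ.velocity t₀ s) (deriv (ℓ.y t₀) s)))) t₀ := by
  have hαβ : α < β := W.left_lt.trans W.lt_right
  obtain ⟨c, hc1, hc2⟩ := exists_between ht₀.1
  obtain ⟨d, hd1, hd2⟩ := exists_between ht₀.2
  have hcd : Icc c d ∈ 𝓝 t₀ := Icc_mem_nhds hc2 hd1
  have hIco : ∀ t ∈ Icc c d, t ∈ Ico 0 Te := fun t ht => ⟨(hc1.trans_le ht.1).le, ht.2.trans_lt hd2⟩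
  have ht₀' : t₀ ∈ Icc c d := ⟨hc2.le, hd1.le⟩
  have hQ : Icc c d ×ˢ Icc α β ⊆ Ico 0 Te ×ˢ univ := fun p hp => ⟨hIco _ hp.1, mem_univ _⟩
  set Φ := fun p : ℝ × E3 => φ p.1 p.2 with hΦ
  have hdΦ : Continuous (fderiv ℝ Φ) := hφ.continuous_fderiv (by norm_num)
  have hyt : ∀ t ∈ Icc c d, ∀ s, HasDerivAt (fun r => ℓ.y r s) (ℓ.velocity t s) t := fun t ht s =>
    (ℓ.hasDerivWithinAt_velocity (hIco t ht)).hasDerivAt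
      (Ico_mem_nhds (hc1.trans_le ht.1) (ht.2.trans_lt hd2))
  have hys : ∀ t ∈ Icc c d, ∀ s, HasDerivAt (ℓ.y t) (deriv (ℓ.y t) s) s := fun t ht s =>
    ℓ.hasDerivAt_param (hIco t ht)
  have hφt : ∀ t ∈ Icc c d, ∀ s, HasDerivAt (fun r => φ r (ℓ.y r s))
      (fderiv ℝ Φ (t, ℓ.y t s) (1, ℓ.velocity t s)) t := fun t ht s =>
    ((hφ.differentiable (by norm_num) (t, ℓ.y t s)).hasFDerivAt).comp_hasDerivAt
      (f := fun r => (r, ℓ.y r s)) t ((hasDerivAt_id t).prodMk (hyt t ht s))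
  have hφs : ∀ t ∈ Icc c d, ∀ s, HasDerivAt (fun r => φ t (ℓ.y t r))
      (fderiv ℝ Φ (t, ℓ.y t s) (0, deriv (ℓ.y t) s)) s := fun t ht s => by
    have := (hasFDerivAt_space hφ t (ℓ.y t s)).comp_hasDerivAt s (hys t ht s)
    exact this
  have hY : ContinuousOn (fun p : ℝ × ℝ => (p.1, ℓ.y p.1 p.2)) (Icc c d ×ˢ Icc α β) :=
    continuousOn_fst.prodMk (ℓ.continuousOn_param.mono hQ)
  have hu := ℓ.continuousOn_velocity.mono hQ
  have hw := ℓ.continuousOn_deriv.mono hQ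
  have hΦt : ContinuousOn (fun p : ℝ × ℝ => fderiv ℝ Φ (p.1, ℓ.y p.1 p.2) (1, ℓ.velocity p.1 p.2))
      (Icc c d ×ˢ Icc α β) :=
    (hdΦ.comp_continuousOn hY).clm_apply (continuousOn_const.prodMk hu)
  have hΦs : ContinuousOn (fun p : ℝ × ℝ => fderiv ℝ Φ (p.1, ℓ.y p.1 p.2)
      (0, deriv (ℓ.y p.1) p.2)) (Icc c d ×ˢ Icc α β) :=
    (hdΦ.comp_continuousOn hY).clm_apply (continuousOn_const.prodMk hw)
  have hyc : ∀ t ∈ Icc c d, Continuous (ℓ.y t) := fun t ht => ℓ.continuous_y (hIco t ht)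
  have hyc' : ∀ t ∈ Icc c d, Continuous (deriv (ℓ.y t)) := fun t ht =>
    ℓ.continuous_deriv_y (hIco t ht)
  have hφc : ∀ t ∈ Icc c d, Continuous (fun s => φ t (ℓ.y t s)) := fun t ht =>
    continuous_iff_continuousAt.2 fun s => (hφs t ht s).continuousAt
  have hslice : ∀ t ∈ Icc c d, MapsTo (fun s : ℝ => (t, s)) (Icc α β) (Icc c d ×ˢ Icc α β) :=
    fun t ht s hs => ⟨ht, hs⟩
  have hΦsc : ∀ t ∈ Icc c d, ContinuousOn
      (fun s => fderiv ℝ Φ (t, ℓ.y t s) (0, deriv (ℓ.y t) s)) (Icc α β) := fun t ht =>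
    hΦs.comp (f := fun s : ℝ => (t, s)) (by fun_prop) (hslice t ht)
  -- the part where the tangent vector is frozen
  have hA : HasDerivAt (fun t => ∫ s in α..β, inner ℝ (φ t (ℓ.y t s)) (deriv (ℓ.y t₀) s))
      (∫ s in α..β, inner ℝ (fderiv ℝ Φ (t₀, ℓ.y t₀ s) (1, ℓ.velocity t₀ s))
        (deriv (ℓ.y t₀) s)) t₀ := by
    obtain ⟨C₁, hC₁⟩ := exists_lipschitz_bound (G := fun t s => φ t (ℓ.y t s)) ht₀'
      (fun t ht s _ => hφt t ht s) hΦt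
    obtain ⟨C₂, hC₂⟩ := isCompact_Icc.exists_bound_of_continuousOn
      (hyc' t₀ ht₀').continuousOn (s := Icc α β)
    refine hasDerivAt_intervalIntegral_of_bound hαβ.le (C := C₁ * C₂) ?_ ?_ ?_ ?_
    · filter_upwards [hcd] with t ht
      exact ((hφc t ht).inner (hyc' t₀ ht₀')).continuousOn
    · exact (hΦt.comp (f := fun s : ℝ => (t₀, s)) (by fun_prop) (hslice t₀ ht₀')).inner
        (hyc' t₀ ht₀').continuousOn
    · filter_upwards [hcd] with t ht s hs
      rw [← inner_sub_left]
      have h1 := hC₁ t ht s hs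
      calc _ ≤ ‖φ t (ℓ.y t s) - φ t₀ (ℓ.y t₀ s)‖ * ‖deriv (ℓ.y t₀) s‖ := abs_real_inner_le_norm _ _
        _ ≤ (C₁ * |t - t₀|) * C₂ := mul_le_mul h1 (hC₂ s hs) (norm_nonneg _)
            ((norm_nonneg _).trans h1)
        _ = _ := by ring
    · intro s hs
      simpa using (hφt t₀ ht₀' s).inner ℝ (hasDerivAt_const t₀ (deriv (ℓ.y t₀) s))
  -- the variation of the tangent vector, after an integration by parts
  have hB : HasDerivAt (fun t => ∫ s in α..β, inner ℝ
        (fderiv ℝ Φ (t, ℓ.y t s) (0, deriv (ℓ.y t) s)) (ℓ.y t s - ℓ.y t₀ s))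
      (∫ s in α..β, inner ℝ (fderiv ℝ Φ (t₀, ℓ.y t₀ s) (0, deriv (ℓ.y t₀) s))
        (ℓ.velocity t₀ s)) t₀ := by
    obtain ⟨C₁, hC₁⟩ := exists_lipschitz_bound (G := ℓ.y) ht₀'
      (fun t ht s _ => hyt t ht s) hu
    obtain ⟨C₂, hC₂⟩ := (isCompact_Icc.prod isCompact_Icc).exists_bound_of_continuousOn hΦs
    refine hasDerivAt_intervalIntegral_of_bound hαβ.le (C := C₁ * C₂) ?_ ?_ ?_ ?_
    · filter_upwards [hcd] with t ht
      exact (hΦsc t ht).inner ((hyc t ht).sub (hyc t₀ ht₀')).continuousOn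
    · exact (hΦsc t₀ ht₀').inner (hu.comp (f := fun s : ℝ => (t₀, s)) (by fun_prop)
        (hslice t₀ ht₀'))
    · filter_upwards [hcd] with t ht s hs
      rw [sub_self (ℓ.y t₀ s), inner_zero_right, sub_zero]
      have h1 := hC₁ t ht s hs
      have h2 := hC₂ (t, s) ⟨ht, hs⟩
      calc _ ≤ ‖fderiv ℝ Φ (t, ℓ.y t s) (0, deriv (ℓ.y t) s)‖ * ‖ℓ.y t s - ℓ.y t₀ s‖ :=
            abs_real_inner_le_norm _ _
        _ ≤ C₂ * (C₁ * |t - t₀|) := mul_le_mul h2 h1 (norm_nonneg _) ((norm_nonneg _).trans h2)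
        _ = _ := by ring
    · intro s hs
      refine hasDerivAt_inner_of_eq_zero ?_ ((hyt t₀ ht₀' s).sub_const _) (sub_self _)
      have := hΦs.comp (f := fun t : ℝ => (t, s)) (s := Icc c d) (by fun_prop)
        (fun t ht => ⟨ht, hs⟩)
      exact this.continuousAt hcd
  -- A `C¹` parametrization need not have the mixed derivative `∂ₜ∂ₛy`. Therefore `∂ₛy(t)` is split
  -- into `∂ₛy(t₀)` and `∂ₛ(y(t) - y(t₀))`, and the second derivative is moved to the test field.
  have hparts : ∀ t ∈ Icc c d,
      ∫ s in α..β, inner ℝ (φ t (ℓ.y t s)) (deriv (ℓ.y t) s) =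
      (∫ s in α..β, inner ℝ (φ t (ℓ.y t s)) (deriv (ℓ.y t₀) s)) -
      ∫ s in α..β, inner ℝ
        (fderiv ℝ Φ (t, ℓ.y t s) (0, deriv (ℓ.y t) s)) (ℓ.y t s - ℓ.y t₀ s) := by
    intro t ht
    have i1 : IntervalIntegrable (fun s => inner ℝ (φ t (ℓ.y t s)) (deriv (ℓ.y t) s)) volume α β :=
      ((hφc t ht).inner (hyc' t ht)).intervalIntegrable _ _
    have i2 : IntervalIntegrable (fun s => inner ℝ (φ t (ℓ.y t s)) (deriv (ℓ.y t₀) s))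
        volume α β := ((hφc t ht).inner (hyc' t₀ ht₀')).intervalIntegrable _ _
    have i3 : IntervalIntegrable (fun s => inner ℝ
        (fderiv ℝ Φ (t, ℓ.y t s) (0, deriv (ℓ.y t) s)) (ℓ.y t s - ℓ.y t₀ s)) volume α β := by
      apply ContinuousOn.intervalIntegrable
      rw [uIcc_of_le hαβ.le]
      exact (hΦsc t ht).inner ((hyc t ht).sub (hyc t₀ ht₀')).continuousOn
    have hftc := intervalIntegral.integral_eq_sub_of_hasDerivAt
      (f := fun s => inner ℝ (φ t (ℓ.y t s)) (ℓ.y t s - ℓ.y t₀ s))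
      (fun s _ => (hφs t ht s).inner ℝ ((hys t ht s).sub (hys t₀ ht₀' s))) (a := α) (b := β) (by
        have := (i1.sub i2).add i3
        refine this.congr fun s _ => ?_
        simp [inner_sub_right])
    -- The boundary terms agree for a closed curve by periodicity; for an open one each is zero,
    -- since the ends of the window lie outside `K`, or `t` lies outside the time support.
    have hbd : inner ℝ (φ t (ℓ.y t β)) (ℓ.y t β - ℓ.y t₀ β) -
        inner ℝ (φ t (ℓ.y t α)) (ℓ.y t α - ℓ.y t₀ α) = 0 := by
      rcases W.boundary with h | h
      · rw [h t (hIco t ht), h t₀ (hIco t₀ ht₀')]; simp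
      · by_cases htJ : t ∈ Icc a b
        · rw [hφK _ _ (Or.inr (h t htJ).1), hφK _ _ (Or.inr (h t htJ).2)]; simp
        · rw [hφK _ _ (Or.inl htJ), hφK _ _ (Or.inl htJ)]; simp
    rw [hbd] at hftc
    have hsum : ∫ s in α..β, (inner ℝ (φ t (ℓ.y t s)) (deriv (ℓ.y t) s - deriv (ℓ.y t₀) s) +
        inner ℝ (fderiv ℝ Φ (t, ℓ.y t s) (0, deriv (ℓ.y t) s)) (ℓ.y t s - ℓ.y t₀ s)) =
        (∫ s in α..β, inner ℝ (φ t (ℓ.y t s)) (deriv (ℓ.y t) s)) -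
        (∫ s in α..β, inner ℝ (φ t (ℓ.y t s)) (deriv (ℓ.y t₀) s)) +
        ∫ s in α..β, inner ℝ
          (fderiv ℝ Φ (t, ℓ.y t s) (0, deriv (ℓ.y t) s)) (ℓ.y t s - ℓ.y t₀ s) := by
      rw [← intervalIntegral.integral_sub i1 i2, ← intervalIntegral.integral_add (i1.sub i2) i3]
      simp only [inner_sub_right]
    rw [hsum] at hftc
    linarith
  have hAB := (hA.sub hB).congr_of_eventuallyEq
    (f₁ := fun t => ∫ s in α..β, inner ℝ (φ t (ℓ.y t s)) (deriv (ℓ.y t) s))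
    (by filter_upwards [hcd] with t ht; exact hparts t ht)
  refine hAB.congr_deriv ?_
  symm
  rw [← intervalIntegral.integral_sub]
  · refine intervalIntegral.integral_congr fun s _ => ?_
    -- The spatial derivative enters only through its antisymmetric part, which is the rotation.
    rw [← inner_rot_cross, fderiv_space hφ, fderiv_space hφ, deriv_time hφ]
    have : ((1 : ℝ), ℓ.velocity t₀ s) = (1, 0) + (0, ℓ.velocity t₀ s) := by simp
    rw [this, map_add, inner_add_left]
    ring
  · apply ContinuousOn.intervalIntegrable
    rw [uIcc_of_le hαβ.le]
    exact (hΦt.comp (f := fun s : ℝ => (t₀, s)) (by fun_prop) (hslice t₀ ht₀')).inner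
        (hyc' t₀ ht₀').continuousOn
  · apply ContinuousOn.intervalIntegrable
    rw [uIcc_of_le hαβ.le]
    exact (hΦsc t₀ ht₀').inner (hu.comp (f := fun s : ℝ => (t₀, s)) (by fun_prop)
        (hslice t₀ ht₀'))

end MovingCurve
-- The weak equation in terms of the defect.
lemma continuous_mulVec3 (b : E3) : Continuous fun A : Matrix (Fin 3) (Fin 3) ℝ => mulVec3 A b :=
  (PiLp.continuous_toLp 2 _).comp (continuous_id.matrix_mulVec continuous_const)

namespace MovingCurve
variable {Ω : Set E3} {Te : ℝ} (ℓ : MovingCurve Ω Te)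

/-- The defect of the moving curve to be a solution of the slip plane equation. -/
noncomputable def defect (f : ℝ → ℝ) (T : ℝ → E3 → Matrix (Fin 3) (Fin 3) ℝ) (b g : E3)
    (t s : ℝ) : E3 :=
  cross (ℓ.velocity t s) (deriv (ℓ.y t) s) -
    (f (inner ℝ g (mulVec3 (T t (ℓ.y t s)) b)) * ‖deriv (ℓ.y t) s‖) • g

variable {f : ℝ → ℝ} {T : ℝ → E3 → Matrix (Fin 3) (Fin 3) ℝ} {b g : E3}

lemma continuousOn_speed (hf : Continuous f)
    (hT : ContinuousOn (fun p : ℝ × E3 => T p.1 p.2) (Icc 0 Te ×ˢ closure Ω)) :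
    ContinuousOn (fun p : ℝ × E3 => f (inner ℝ g (mulVec3 (T p.1 p.2) b)))
      (Icc 0 Te ×ˢ closure Ω) :=
  hf.comp_continuousOn (continuousOn_const.inner ((continuous_mulVec3 b).comp_continuousOn hT))

lemma continuousOn_speed_param (hf : Continuous f)
    (hT : ContinuousOn (fun p : ℝ × E3 => T p.1 p.2) (Icc 0 Te ×ˢ closure Ω)) :
    ContinuousOn (fun p : ℝ × ℝ => (f (inner ℝ g (mulVec3 (T p.1 (ℓ.y p.1 p.2)) b)) *
      ‖deriv (ℓ.y p.1) p.2‖) • g) (Ico 0 Te ×ˢ univ) :=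
  (((continuousOn_speed hf hT).comp (continuousOn_fst.prodMk ℓ.continuousOn_param)
    fun _ hp => ⟨Ico_subset_Icc_self hp.1, subset_closure (ℓ.mem _ hp.1 _)⟩).mul
      ℓ.continuousOn_deriv.norm).smul continuousOn_const

lemma continuousOn_cross_velocity :
    ContinuousOn (fun p : ℝ × ℝ => cross (ℓ.velocity p.1 p.2) (deriv (ℓ.y p.1) p.2))
      (Ico 0 Te ×ˢ univ) :=
  continuous_cross.comp_continuousOn (ℓ.continuousOn_velocity.prodMk ℓ.continuousOn_deriv)

lemma continuousOn_defect (hf : Continuous f)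
    (hT : ContinuousOn (fun p : ℝ × E3 => T p.1 p.2) (Icc 0 Te ×ˢ closure Ω)) :
    ContinuousOn (fun p : ℝ × ℝ => ℓ.defect f T b g p.1 p.2) (Ico 0 Te ×ˢ univ) :=
  ℓ.continuousOn_cross_velocity.sub (ℓ.continuousOn_speed_param hf hT)

lemma continuousOn_comp_param {h : ℝ × E3 → E3} (hh : Continuous h) :
    ContinuousOn (fun p : ℝ × ℝ => h (p.1, ℓ.y p.1 p.2)) (Ico 0 Te ×ˢ univ) :=
  hh.comp_continuousOn (continuousOn_fst.prodMk ℓ.continuousOn_param)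

/-- The weak form of the slip plane equation, expressed by the defect. -/
lemma Window.weak_identity (hΩ : IsOpen Ω) (hf : Continuous f)
    (hT : ContinuousOn (fun p : ℝ × E3 => T p.1 p.2) (Icc 0 Te ×ˢ closure Ω)) (hb : b ≠ 0)
    {ρ : ℝ → DislocationMeasure Ω} (hρ : ∀ t ∈ Ico 0 Te, ℓ.IsDislocationMeasureOf b t (ρ t))
    {s₀ α β c d : ℝ} {K : Set E3} (hc : 0 < c) (hcd : c < d) (hd : d < Te)
    (W : ℓ.Window s₀ K (Icc c d) α β) {φ : ℝ → E3 → E3}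
    (hφ : ContDiff ℝ 1 (fun p : ℝ × E3 => φ p.1 p.2))
    (hsupp : tsupport (fun p : ℝ × E3 => φ p.1 p.2) ⊆ Ioo c d ×ˢ K) :
    IntegrableOn (fun t => pairing (ρ t).total (ρ t).dir (fun x => deriv (fun r => φ r x) t))
      (Ioo 0 Te) ∧
    IntegrableOn (fun t => pairing (ρ t).total
      (fun x => f (inner ℝ g (mulVec3 (T t x) b)) • g) (rot (φ t))) (Ioo 0 Te) ∧
    (- ∫ t in Ioo 0 Te, pairing (ρ t).total (ρ t).dir (fun x => deriv (fun r => φ r x) t)) -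
      ∫ t in Ioo 0 Te, pairing (ρ t).total (fun x => f (inner ℝ g (mulVec3 (T t x) b)) • g)
        (rot (φ t)) =
    ‖b‖ * ∫ t in Ioo 0 Te, ∫ s in α..β, inner ℝ (rot (φ t) (ℓ.y t s)) (ℓ.defect f T b g t s) := by
  have hIoo : Ioo 0 Te ×ˢ (univ : Set ℝ) ⊆ Ico 0 Te ×ˢ univ :=
    prod_mono_left Ioo_subset_Ico_self
  have hnot : ∀ t x, t ∉ Ioo c d ∨ x ∉ K → (t, x) ∉ tsupport (fun p : ℝ × E3 => φ p.1 p.2) :=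
    fun t x h hp => h.elim (fun h => h (hsupp hp).1) (fun h => h (hsupp hp).2)
  have hφ0 : ∀ t x, t ∉ Ioo c d ∨ x ∉ K → φ t x = 0 := fun t x h =>
    image_eq_zero_of_notMem_tsupport (f := fun p : ℝ × E3 => φ p.1 p.2) (hnot t x h)
  have hdt0 : ∀ t x, t ∉ Ioo c d ∨ x ∉ K → deriv (fun r => φ r x) t = 0 := fun t x h => by
    rw [deriv_time hφ, fderiv_eq_zero_of_notMem _ (hnot t x h)]; rfl
  have hrot0 : ∀ t x, t ∉ Ioo c d ∨ x ∉ K → rot (φ t) x = 0 := fun t x h =>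
    rot_eq_zero_of_notMem hφ t x (hnot t x h)
  have hdtc := continuous_deriv_time hφ
  have hrotc := continuous_rot_space hφ
  have hslice : ∀ t : ℝ, Continuous fun x : E3 => (t, x) := fun t => by fun_prop
  -- the three line integrals
  set c₁ : ℝ → ℝ := fun t => ∫ s in α..β,
    inner ℝ (deriv (fun r => φ r (ℓ.y t s)) t) (deriv (ℓ.y t) s) with hc₁
  set c₂ : ℝ → ℝ := fun t => ∫ s in α..β,
    inner ℝ (rot (φ t) (ℓ.y t s)) (cross (ℓ.velocity t s) (deriv (ℓ.y t) s)) with hc₂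
  set c₃ : ℝ → ℝ := fun t => ∫ s in α..β, inner ℝ (rot (φ t) (ℓ.y t s))
    ((f (inner ℝ g (mulVec3 (T t (ℓ.y t s)) b)) * ‖deriv (ℓ.y t) s‖) • g) with hc₃
  have k₁ : ContinuousOn (fun p : ℝ × ℝ =>
      inner ℝ (deriv (fun r => φ r (ℓ.y p.1 p.2)) p.1) (deriv (ℓ.y p.1) p.2))
      (Ioo 0 Te ×ˢ univ) :=
    ((ℓ.continuousOn_comp_param hdtc).inner ℓ.continuousOn_deriv).mono hIoo
  have k₂ : ContinuousOn (fun p : ℝ × ℝ => inner ℝ (rot (φ p.1) (ℓ.y p.1 p.2))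
      (cross (ℓ.velocity p.1 p.2) (deriv (ℓ.y p.1) p.2))) (Ioo 0 Te ×ˢ univ) :=
    ((ℓ.continuousOn_comp_param hrotc).inner ℓ.continuousOn_cross_velocity).mono hIoo
  have k₃ : ContinuousOn (fun p : ℝ × ℝ => inner ℝ (rot (φ p.1) (ℓ.y p.1 p.2))
      ((f (inner ℝ g (mulVec3 (T p.1 (ℓ.y p.1 p.2)) b)) * ‖deriv (ℓ.y p.1) p.2‖) • g))
      (Ioo 0 Te ×ˢ univ) :=
    ((ℓ.continuousOn_comp_param hrotc).inner (ℓ.continuousOn_speed_param hf hT)).mono hIoo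
  have m₁ : ContinuousOn c₁ (Ioo 0 Te) := continuousOn_intervalIntegral
    (h := fun t s => inner ℝ (deriv (fun r => φ r (ℓ.y t s)) t) (deriv (ℓ.y t) s)) k₁
  have m₂ : ContinuousOn c₂ (Ioo 0 Te) := continuousOn_intervalIntegral
    (h := fun t s => inner ℝ (rot (φ t) (ℓ.y t s)) (cross (ℓ.velocity t s) (deriv (ℓ.y t) s))) k₂
  have m₃ : ContinuousOn c₃ (Ioo 0 Te) := continuousOn_intervalIntegral
    (h := fun t s => inner ℝ (rot (φ t) (ℓ.y t s))
    ((f (inner ℝ g (mulVec3 (T t (ℓ.y t s)) b)) * ‖deriv (ℓ.y t) s‖) • g)) k₃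
  have z₁ : ∀ t ∉ Ioo c d, c₁ t = 0 := fun t ht => by simp [hc₁, hdt0 t _ (Or.inl ht)]
  have z₂ : ∀ t ∉ Ioo c d, c₂ t = 0 := fun t ht => by simp [hc₂, hrot0 t _ (Or.inl ht)]
  have z₃ : ∀ t ∉ Ioo c d, c₃ t = 0 := fun t ht => by simp [hc₃, hrot0 t _ (Or.inl ht)]
  have i₁ := integrableOn_of_continuousOn_of_eq_zero hc hd m₁ z₁
  have i₂ := integrableOn_of_continuousOn_of_eq_zero hc hd m₂ z₂
  have i₃ := integrableOn_of_continuousOn_of_eq_zero hc hd m₃ z₃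
  have p₁ : EqOn (fun t => ‖b‖ * c₁ t)
      (fun t => pairing (ρ t).total (ρ t).dir (fun x => deriv (fun r => φ r x) t)) (Ioo 0 Te) := by
    intro t ht
    by_cases htJ : t ∈ Ioo c d
    · exact (W.pairing_dir_eq ℓ hΩ (Ioo_subset_Ico_self ht) hb (hρ t (Ioo_subset_Ico_self ht))
        (Ioo_subset_Icc_self htJ) (hdtc.comp (hslice t)) fun x hx => hdt0 t x (Or.inr hx)).symm
    · simp [z₁ t htJ, pairing, hdt0 t _ (Or.inl htJ)]
  have p₃ : EqOn (fun t => ‖b‖ * c₃ t) (fun t => pairing (ρ t).total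
      (fun x => f (inner ℝ g (mulVec3 (T t x) b)) • g) (rot (φ t))) (Ioo 0 Te) := by
    intro t ht
    by_cases htJ : t ∈ Ioo c d
    · refine (W.pairing_normal_eq ℓ (k := fun x => f (inner ℝ g (mulVec3 (T t x) b)))
        hΩ (Ioo_subset_Ico_self ht) hb (hρ t (Ioo_subset_Ico_self ht))
        (Ioo_subset_Icc_self htJ) (hrotc.comp (hslice t)) (fun x hx => hrot0 t x (Or.inr hx))
        ?_ g).symm
      exact (continuousOn_speed hf hT).comp (f := fun x : E3 => (t, x)) (hslice t).continuousOn
        fun x hx => ⟨Ioo_subset_Icc_self ht, subset_closure hx⟩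
    · simp [z₃ t htJ, pairing, hrot0 t _ (Or.inl htJ)]
  refine ⟨IntegrableOn.congr_fun (i₁.const_mul ‖b‖) p₁ measurableSet_Ioo,
    IntegrableOn.congr_fun (i₃.const_mul ‖b‖) p₃ measurableSet_Ioo, ?_⟩
  rw [← setIntegral_congr_fun measurableSet_Ioo p₁, ← setIntegral_congr_fun measurableSet_Ioo p₃,
    integral_const_mul, integral_const_mul]
  -- conservation of the line integral of the test field
  have hcons : ∫ t in Ioo 0 Te, (c₁ t + c₂ t) = 0 := by
    have hsub : Icc c d ⊆ Ioo 0 Te := fun t ht => ⟨hc.trans_le ht.1, ht.2.trans_lt hd⟩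
    rw [setIntegral_eq_of_subset_of_forall_sdiff_eq_zero measurableSet_Ioo
      (Ioo_subset_Icc_self.trans hsub) (fun t ht => by rw [z₁ t ht.2, z₂ t ht.2, add_zero]),
      ← integral_Ioc_eq_integral_Ioo, ← intervalIntegral.integral_of_le hcd.le]
    have hderiv : ∀ t ∈ uIcc c d, HasDerivAt
        (fun t => ∫ s in α..β, inner ℝ (φ t (ℓ.y t s)) (deriv (ℓ.y t) s)) (c₁ t + c₂ t) t := by
      intro t ht
      rw [uIcc_of_le hcd.le] at ht
      have ht' := hsub ht
      refine (W.hasDerivAt_lineIntegral ℓ ht' hφ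
        fun t x h => hφ0 t x (h.imp_left fun h h' => h (Ioo_subset_Icc_self h'))).congr_deriv ?_
      have hcs : Continuous fun s : ℝ => (t, s) := by fun_prop
      refine intervalIntegral.integral_add ?_ ?_
      · exact (k₁.comp_continuous hcs fun s => ⟨ht', mem_univ _⟩).intervalIntegrable _ _
      · exact (k₂.comp_continuous hcs fun s => ⟨ht', mem_univ _⟩).intervalIntegrable _ _
    rw [intervalIntegral.integral_eq_sub_of_hasDerivAt hderiv]
    · simp [hφ0 c _ (Or.inl left_notMem_Ioo), hφ0 d _ (Or.inl right_notMem_Ioo)]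
    · refine ContinuousOn.intervalIntegrable ?_
      rw [uIcc_of_le hcd.le]
      exact (m₁.add m₂).mono hsub
  rw [integral_add i₁ i₂] at hcons
  have hdef : ∫ t in Ioo 0 Te, ∫ s in α..β,
      inner ℝ (rot (φ t) (ℓ.y t s)) (ℓ.defect f T b g t s) =
      (∫ t in Ioo 0 Te, c₂ t) - ∫ t in Ioo 0 Te, c₃ t := by
    rw [← integral_sub i₂ i₃]
    refine setIntegral_congr_fun measurableSet_Ioo fun t ht => ?_
    have hcs : Continuous fun s : ℝ => (t, s) := by fun_prop
    simp only [hc₂, hc₃]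
    refine Eq.trans (intervalIntegral.integral_congr fun s _ => ?_) (intervalIntegral.integral_sub
      ((k₂.comp_continuous hcs fun s => ⟨ht, mem_univ _⟩).intervalIntegrable _ _)
      ((k₃.comp_continuous hcs fun s => ⟨ht, mem_univ _⟩).intervalIntegrable _ _))
    simp only [defect, inner_sub_right]
  rw [hdef]
  linear_combination (-‖b‖) * hcons

/-- Every test field is covered by a window. -/
lemma exists_window_of_test (hTe : 0 < Te) (s₀ : ℝ) {φ : ℝ → E3 → E3}
    (hφ : IsSpaceTimeTestField Ω Te φ) : ∃ c d α β K, 0 < c ∧ c < d ∧ d < Te ∧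
      ℓ.Window s₀ K (Icc c d) α β ∧ tsupport (fun p : ℝ × E3 => φ p.1 p.2) ⊆ Ioo c d ×ˢ K := by
  obtain ⟨-, hcpt, hsupp⟩ := hφ
  set S := tsupport (fun p : ℝ × E3 => φ p.1 p.2) with hS
  have hS' : IsCompact S := hcpt
  obtain ⟨c, d, hc, hcd, hd, hJ⟩ := exists_Ioo_of_isCompact (hS'.image continuous_fst) hTe
    (image_subset_iff.2 fun p hp => (hsupp hp).1)
  obtain ⟨α, β, W⟩ := ℓ.exists_window s₀ (hS'.image continuous_snd)
    (image_subset_iff.2 fun p hp => (hsupp hp).2) (isCompact_Icc (a := c) (b := d))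
    (fun t ht => ⟨(hc.trans_le ht.1).le, ht.2.trans_lt hd⟩)
  exact ⟨c, d, α, β, _, hc, hcd, hd, W, fun p hp => ⟨hJ ⟨p, hp, rfl⟩, ⟨p, hp, rfl⟩⟩⟩

lemma solves_of_defect_eq_zero (hΩ : IsOpen Ω) (hTe : 0 < Te) (hf : Continuous f)
    (hT : ContinuousOn (fun p : ℝ × E3 => T p.1 p.2) (Icc 0 Te ×ˢ closure Ω)) (hb : b ≠ 0)
    {ρ : ℝ → DislocationMeasure Ω} (hρ : ∀ t ∈ Ico 0 Te, ℓ.IsDislocationMeasureOf b t (ρ t))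
    (h : ∀ t ∈ Ico 0 Te, ∀ s, ℓ.defect f T b g t s = 0) :
    SolvesSlipPlaneEquation Te f T b g ρ := by
  intro φ hφ
  -- The base point 0 of the window is arbitrary; only the covering of the support matters.
  obtain ⟨c, d, α, β, K, hc, hcd, hd, W, hsupp⟩ := ℓ.exists_window_of_test hTe 0 hφ
  obtain ⟨h1, h2, h3⟩ := W.weak_identity ℓ (g := g) hΩ hf hT hb hρ hc hcd hd
    (hφ.1.of_le (by exact_mod_cast le_top)) hsupp
  refine ⟨h1, h2, ?_⟩
  rw [← sub_eq_zero, h3, setIntegral_congr_fun (g := fun _ => (0 : ℝ)) measurableSet_Ioo]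
  · simp
  · intro t ht
    simp [h t (Ioo_subset_Ico_self ht)]

end MovingCurve
-- Localization at a point of the curve.
/-- A continuous density on a curve that is normal to the curve at a point where the curve is
regular vanishes there if it annihilates the rotations of all test fields near that point. -/
lemma eq_zero_of_forall_integral_rot_eq_zero {γ m : ℝ → E3} {w : E3} {s₀ α β r : ℝ}
    (hγ : Continuous γ) (hγ' : HasDerivAt γ w s₀) (hw : w ≠ 0) (hm : Continuous m)
    (hnormal : inner ℝ w (m s₀) = 0) (hα : α < s₀) (hβ : s₀ < β)
    (huniq : ∀ s ∈ Icc α β, γ s = γ s₀ → s = s₀) (hr : 0 < r)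
    (h : ∀ ψ : E3 → E3, IsTestField (Metric.closedBall (γ s₀) r) ψ →
      ∫ s in α..β, inner ℝ (rot ψ (γ s)) (m s) = 0) : m s₀ = 0 := by
  by_contra hm0
  have hαβ : α < β := hα.trans hβ
  -- Normality of `m s₀` to `w` makes `n` nonzero. A test field `ζ w` gives `rot(ζ w) · m = ∇ζ · (w
  -- × m)`, so a gradient of `ζ` along `n` makes this positive at `s₀`.
  set n := cross w (m s₀) with hn
  have hwn : inner ℝ w n = 0 := by rw [real_inner_comm]; exact inner_cross_self_left w (m s₀)
  have hn0 : 0 < inner ℝ n n := by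
    rw [hn, inner_cross_cross, hnormal, zero_mul, sub_zero]
    exact mul_pos (real_inner_self_pos.2 hw) (real_inner_self_pos.2 hm0)
  -- The continuous difference quotient has no zero on the window, by regularity at `s₀` and
  -- uniqueness elsewhere. Its bounds `c` and `C` make `|γ s - γ s₀|` comparable to `|s - s₀|` on
  -- the whole window.
  set q := dslope γ s₀ with hqdef
  have hq : Continuous q := by
    refine continuous_iff_continuousAt.2 fun s => ?_
    rcases eq_or_ne s s₀ with rfl | hs
    · exact continuousAt_dslope_same.2 hγ'.differentiableAt
    · exact (continuousAt_dslope_of_ne hs).2 hγ.continuousAt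
  have hq0 : q s₀ = w := by rw [hqdef, dslope_same, hγ'.deriv]
  have hγq : ∀ s, γ s - γ s₀ = (s - s₀) • q s := fun s => (sub_smul_dslope γ s₀ s).symm
  have hqne : ∀ s ∈ Icc α β, q s ≠ 0 := fun s hs h0 => by
    rcases eq_or_ne s s₀ with rfl | hne
    · exact hw (hq0 ▸ h0)
    · refine hne (huniq s hs (sub_eq_zero.1 ?_))
      rw [hγq, h0, smul_zero]
  obtain ⟨s₁, hs₁, hmin⟩ := isCompact_Icc.exists_isMinOn (nonempty_Icc.2 hαβ.le)
    hq.norm.continuousOn (s := Icc α β)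
  set c := ‖q s₁‖ with hc
  have hc0 : 0 < c := norm_pos_iff.2 (hqne s₁ hs₁)
  obtain ⟨C, hC⟩ := isCompact_Icc.exists_bound_of_continuousOn hq.continuousOn (s := Icc α β)
  have hcC : c ≤ C := hC s₁ hs₁
  have hC0 : 0 < C := hc0.trans_le hcC
  let κ : ContDiffBump (0 : E3) := ⟨1, 2, one_pos, one_lt_two⟩
  have hκ : ContDiff ℝ ∞ (κ : E3 → ℝ) := κ.contDiff
  have hκ0 : ∀ z : E3, 2 ≤ ‖z‖ → κ z = 0 := fun z hz => κ.zero_of_le_dist (by simpa using hz)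
  -- The nonnegative bump has a minimum at each of its zeros, which includes the sphere `‖z‖ = 2`.
  have hκ' : ∀ z : E3, 2 ≤ ‖z‖ → fderiv ℝ κ z = 0 := fun z hz =>
    IsLocalMin.fderiv_eq_zero (Eventually.of_forall fun x => by rw [hκ0 z hz]; exact κ.nonneg)
  have hκ1 : ∀ z : E3, ‖z‖ ≤ 1 → κ z = 1 := fun z hz =>
    κ.one_of_mem_closedBall (by simpa using hz)
  obtain ⟨D, hD⟩ := κ.hasCompactSupport.fderiv (𝕜 := ℝ) |>.exists_bound_of_continuous
    (hκ.continuous_fderiv (by simp))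
  have hwm : Continuous fun s => cross w (m s) := continuous_cross.comp (continuous_const.prodMk hm)
  obtain ⟨B, hB⟩ := isCompact_Icc.exists_bound_of_continuousOn hwm.continuousOn (s := Icc α β)
  have hD0 : 0 ≤ D := (norm_nonneg _).trans (hD 0)
  have hB0 : 0 ≤ B := (norm_nonneg _).trans (hB s₁ hs₁)
  -- the constants of the blow-up
  set c₁ := inner ℝ n n / 2 with hc₁
  have hc₁0 : 0 < c₁ := half_pos hn0
  -- Chosen so that an error `g₁` over the interval of half-length `R = 2ε/c` costs `ε c₁ / C`, half
  -- of the gain `2 ε c₁ / C` from the core `|s - s₀| ≤ ε / C`. The constant `θ` keeps the error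
  -- below `g₁`.
  set g₁ := c₁ * c / (4 * C) with hg₁
  have hg₁0 : 0 < g₁ := by positivity
  set θ := g₁ * c / (2 * (D * B + 1)) with hθ
  have hθ0 : 0 < θ := by positivity
  have e1 : ∀ᶠ s in 𝓝 s₀, |inner ℝ (q s) n| < θ := by
    have : ContinuousAt (fun s => |inner ℝ (q s) n|) s₀ :=
      ((hq.inner continuous_const).abs).continuousAt
    refine this.eventually_lt_const ?_
    simpa [hq0, hwn] using hθ0
  have e2 : ∀ᶠ s in 𝓝 s₀, c₁ < inner ℝ (cross w (m s)) n := by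
    have : ContinuousAt (fun s => inner ℝ (cross w (m s)) n) s₀ :=
      (hwm.inner continuous_const).continuousAt
    refine this.eventually_const_lt ?_
    exact half_lt_self hn0
  obtain ⟨δ, hδ, hnear⟩ := Metric.eventually_nhds_iff.1
    ((e1.and e2).and (Ioo_mem_nhds hα hβ : ∀ᶠ s in 𝓝 s₀, s ∈ Ioo α β))
  -- The first bound keeps the test field in the given ball, the second gives `R ≤ δ / 2`.
  set ε := min (r / 2) (δ * c / 4) with hε
  have hε0 : 0 < ε := by positivity
  have hεr : 2 * ε ≤ r := by have := min_le_left (r / 2) (δ * c / 4); linarith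
  set R := 2 * ε / c with hR
  have hR0 : 0 < R := by positivity
  have hRδ : R < δ := by
    have := min_le_right (r / 2) (δ * c / 4)
    rw [hR, div_lt_iff₀ hc0]; nlinarith [mul_pos hδ hc0]
  have hnear' : ∀ s, |s - s₀| ≤ R → (|inner ℝ (q s) n| < θ ∧ c₁ < inner ℝ (cross w (m s)) n) ∧
      s ∈ Ioo α β := fun s hs => hnear (by rw [Real.dist_eq]; linarith)
  let ζ : E3 → ℝ := fun x => κ (ε⁻¹ • (x - γ s₀)) * inner ℝ n (x - γ s₀)
  have hζ : ContDiff ℝ ∞ ζ := by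
    refine (hκ.comp (by fun_prop)).mul ?_
    exact contDiff_const.inner ℝ (contDiff_id.sub contDiff_const)
  have hnormz : ∀ x : E3, ‖ε⁻¹ • (x - γ s₀)‖ = ‖x - γ s₀‖ / ε := fun x => by
    rw [norm_smul, norm_inv, Real.norm_of_nonneg hε0.le]; ring
  have hsupp : tsupport (fun x => ζ x • w) ⊆ Metric.closedBall (γ s₀) (2 * ε) := by
    refine closure_minimal (fun x hx => ?_) Metric.isClosed_closedBall
    rw [mem_closedBall_iff_norm]
    by_contra hgt
    refine hx ?_
    have h2 : κ (ε⁻¹ • (x - γ s₀)) = 0 := hκ0 _ (by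
      rw [hnormz, le_div_iff₀ hε0]; exact (not_le.1 hgt).le)
    simp [ζ, h2]
  have htest : IsTestField (Metric.closedBall (γ s₀) r) (fun x => ζ x • w) :=
    ⟨hζ.smul contDiff_const,
      (isCompact_closedBall _ _).of_isClosed_subset (isClosed_tsupport _) hsupp,
      hsupp.trans (Metric.closedBall_subset_closedBall hεr)⟩
  -- The first term is the gain. The second has the factor `1/ε` from the cutoff, but `|s - s₀|` is
  -- at most of order `ε` where it matters, and `q s · n` is small because `q s₀ = w` is orthogonal
  -- to `n`.
  have hH : ∀ s, inner ℝ (rot (fun x => ζ x • w) (γ s)) (m s) =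
      κ (ε⁻¹ • (γ s - γ s₀)) * inner ℝ (cross w (m s)) n +
        ((s - s₀) * ε⁻¹) * inner ℝ (q s) n *
          fderiv ℝ κ (ε⁻¹ • (γ s - γ s₀)) (cross w (m s)) := by
    intro s
    have d1 : HasFDerivAt (fun x : E3 => ε⁻¹ • (x - γ s₀))
        (ε⁻¹ • ContinuousLinearMap.id ℝ E3) (γ s) :=
      ((hasFDerivAt_id (γ s)).sub_const _).fun_const_smul _
    have d2 : HasFDerivAt (fun x : E3 => κ (ε⁻¹ • (x - γ s₀)))
        ((fderiv ℝ κ (ε⁻¹ • (γ s - γ s₀))).comp (ε⁻¹ • ContinuousLinearMap.id ℝ E3)) (γ s) :=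
      ((hκ.differentiable (by simp) _).hasFDerivAt).comp (γ s) d1
    have d3 : HasFDerivAt (fun x : E3 => inner ℝ n (x - γ s₀)) (innerSL ℝ n) (γ s) :=
      (innerSL ℝ n).hasFDerivAt.comp (γ s) ((hasFDerivAt_id (γ s)).sub_const _)
    have d4 : HasFDerivAt ζ _ (γ s) := d2.mul d3
    rw [inner_rot_smul_const d4]
    simp only [_root_.add_apply, _root_.smul_apply,
      ContinuousLinearMap.comp_apply, ContinuousLinearMap.id_apply, smul_eq_mul, map_smul,
      innerSL_apply_apply]
    have : inner ℝ n (γ s - γ s₀) = (s - s₀) * inner ℝ (q s) n := by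
      rw [hγq, inner_smul_right, real_inner_comm]
    rw [this, real_inner_comm (cross w (m s)) n]
    ring
  set H : ℝ → ℝ := fun s => inner ℝ (rot (fun x => ζ x • w) (γ s)) (m s) with hHdef
  have hHc : Continuous H := by
    have := continuous_rot (htest.1.of_le (by exact_mod_cast le_top))
    exact (this.comp hγ).inner hm
  -- The lower bound on `q` puts these points at distance at least `2ε`, outside the cutoff.
  have hfar : ∀ s ∈ Icc α β, R ≤ |s - s₀| → H s = 0 := by
    intro s hs hRs
    have h2 : 2 ≤ ‖ε⁻¹ • (γ s - γ s₀)‖ := by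
      rw [hnormz, le_div_iff₀ hε0, hγq, norm_smul, Real.norm_eq_abs]
      have h3 : c ≤ ‖q s‖ := hmin hs
      rw [hR, div_le_iff₀ hc0] at hRs
      exact hRs.trans (by gcongr)
    simp only [hHdef, hH, hκ0 _ h2, hκ' _ h2]
    simp
  have herr : ∀ s, |s - s₀| ≤ R → |((s - s₀) * ε⁻¹) * inner ℝ (q s) n *
          fderiv ℝ κ (ε⁻¹ • (γ s - γ s₀)) (cross w (m s))| ≤ g₁ := by
    intro s hs
    have hsαβ := Ioo_subset_Icc_self (hnear' s hs).2
    have h1 : |fderiv ℝ κ (ε⁻¹ • (γ s - γ s₀)) (cross w (m s))| ≤ D * B :=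
      (ContinuousLinearMap.le_opNorm _ _).trans
        (mul_le_mul (hD _) (hB s hsαβ) (norm_nonneg _) hD0)
    rw [abs_mul, abs_mul, abs_mul, abs_inv, abs_of_pos hε0]
    calc |s - s₀| * ε⁻¹ * |inner ℝ (q s) n| * _ ≤ R * ε⁻¹ * θ * (D * B + 1) := by
          have := (hnear' s hs).1.1.le
          gcongr
          linarith
      _ = g₁ := by rw [hR, hθ]; field_simp
  have hlow : ∀ s, |s - s₀| ≤ R → 0 ≤ H s + g₁ := by
    intro s hs
    have h1 := (abs_le.1 (herr s hs)).1
    have h2 : 0 ≤ κ (ε⁻¹ • (γ s - γ s₀)) * inner ℝ (cross w (m s)) n :=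
      mul_nonneg κ.nonneg (hc₁0.le.trans (hnear' s hs).1.2.le)
    simp only [hHdef, hH]
    linarith
  have hR₁R : ε / C ≤ R := by
    rw [hR, div_le_div_iff₀ hC0 hc0]; nlinarith
  have hlow' : ∀ s, |s - s₀| ≤ ε / C → c₁ ≤ H s + g₁ := by
    intro s hs
    have hs' := hs.trans hR₁R
    have h1 := (abs_le.1 (herr s hs')).1
    have h2 : κ (ε⁻¹ • (γ s - γ s₀)) = 1 := by
      refine hκ1 _ ?_
      rw [hnormz, div_le_one hε0, hγq, norm_smul, Real.norm_eq_abs]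
      rw [le_div_iff₀ hC0] at hs
      exact le_trans (by gcongr; exact hC s (Ioo_subset_Icc_self (hnear' s hs').2)) hs
    simp only [hHdef, hH, h2, one_mul] at h1 ⊢
    linarith [(hnear' s hs').1.2]
  have hleft := (hnear' (s₀ - R) (by simp [abs_of_pos hR0])).2
  have hright := (hnear' (s₀ + R) (by simp [abs_of_pos hR0])).2
  have hint : ∫ s in (s₀ - R)..(s₀ + R), H s = 0 := by
    rw [← h _ htest, intervalIntegral.integral_of_le (by linarith),
      intervalIntegral.integral_of_le hαβ.le]
    symm
    refine setIntegral_eq_of_subset_of_forall_sdiff_eq_zero measurableSet_Ioc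
      (Ioc_subset_Ioc hleft.1.le hright.2.le) fun s hs => ?_
    refine hfar s (Ioc_subset_Icc_self hs.1) (not_lt.1 fun hlt => hs.2 ?_)
    have := abs_lt.1 hlt
    exact ⟨by linarith, by linarith⟩
  have hmono : ∫ s in (s₀ - ε / C)..(s₀ + ε / C), (H s + g₁) ≤
      ∫ s in (s₀ - R)..(s₀ + R), (H s + g₁) := by
    have hεC : 0 < ε / C := by positivity
    refine intervalIntegral.integral_mono_interval (by linarith) (by linarith) (by linarith) ?_
      ((hHc.add continuous_const).intervalIntegrable _ _)
    filter_upwards [ae_restrict_mem measurableSet_Ioc] with s hs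
    exact hlow s (abs_le.2 ⟨by linarith [hs.1], by linarith [hs.2]⟩)
  have hconst : ∫ _ in (s₀ - ε / C)..(s₀ + ε / C), c₁ ≤
      ∫ s in (s₀ - ε / C)..(s₀ + ε / C), (H s + g₁) := by
    have hεC : 0 < ε / C := by positivity
    refine intervalIntegral.integral_mono_on (by linarith)
      (continuous_const.intervalIntegrable _ _)
      ((hHc.add continuous_const).intervalIntegrable _ _) fun s hs => ?_
    exact hlow' s (abs_le.2 ⟨by linarith [hs.1], by linarith [hs.2]⟩)
  have hfin := hconst.trans hmono
  rw [intervalIntegral.integral_add (hHc.intervalIntegrable _ _)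
    (continuous_const.intervalIntegrable _ _), hint, intervalIntegral.integral_const,
    intervalIntegral.integral_const, smul_eq_mul, smul_eq_mul, zero_add] at hfin
  have h1 : (s₀ + ε / C - (s₀ - ε / C)) * c₁ = 2 * (ε * c₁ / C) := by ring
  have h2 : (s₀ + R - (s₀ - R)) * g₁ = ε * c₁ / C := by
    rw [hR, hg₁]; field_simp; ring
  rw [h1, h2] at hfin
  have : 0 < ε * c₁ / C := by positivity
  linarith

/-! ### From weak solutions to the pointwise law. -/

namespace MovingCurve
variable {Ω : Set E3} {Te : ℝ} (ℓ : MovingCurve Ω Te)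
variable {f : ℝ → ℝ} {T : ℝ → E3 → Matrix (Fin 3) (Fin 3) ℝ} {b g : E3}

/-- At every time, the defect of a solution annihilates the rotations of test fields. -/
lemma Window.integral_rot_defect_eq_zero (hΩ : IsOpen Ω) (hf : Continuous f)
    (hT : ContinuousOn (fun p : ℝ × E3 => T p.1 p.2) (Icc 0 Te ×ˢ closure Ω)) (hb : b ≠ 0)
    {ρ : ℝ → DislocationMeasure Ω} (hρ : ∀ t ∈ Ico 0 Te, ℓ.IsDislocationMeasureOf b t (ρ t))
    (hsol : SolvesSlipPlaneEquation Te f T b g ρ)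
    {s₀ α β c d t₀ : ℝ} {K : Set E3} (hc : 0 < c) (ht₀ : t₀ ∈ Ioo c d) (hd : d < Te)
    (W : ℓ.Window s₀ K (Icc c d) α β) (hK : K ⊆ Ω) {ψ : E3 → E3} (hψ : IsTestField K ψ) :
    ∫ s in α..β, inner ℝ (rot ψ (ℓ.y t₀ s)) (ℓ.defect f T b g t₀ s) = 0 := by
  set h : ℝ → ℝ := fun t =>
    ∫ s in α..β, inner ℝ (rot ψ (ℓ.y t s)) (ℓ.defect f T b g t s) with hh
  have hcd : c < d := ht₀.1.trans ht₀.2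
  have hψ1 : ContDiff ℝ 1 ψ := hψ.1.of_le (by exact_mod_cast le_top)
  have hsub : Ioo c d ⊆ Ioo 0 Te := Ioo_subset_Ioo hc.le hd.le
  have hcont : ContinuousOn h (Ioo c d) := by
    refine (continuousOn_intervalIntegral (c := 0) (d := Te)
      (h := fun t s => inner ℝ (rot ψ (ℓ.y t s)) (ℓ.defect f T b g t s)) ?_).mono hsub
    exact (((continuous_rot hψ1).comp_continuousOn ℓ.continuousOn_param).inner
      (ℓ.continuousOn_defect hf hT)).mono (prod_mono_left Ioo_subset_Ico_self)
  -- The fundamental lemma of the calculus of variations in time, applied to `χ(t) ψ(x)`; continuity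
  -- of `h` then removes the exceptional null set.
  have hae : ∀ᵐ t, t ∈ Ioo c d → h t = 0 := by
    refine isOpen_Ioo.ae_eq_zero_of_integral_contDiff_smul_eq_zero
      (hcont.locallyIntegrableOn measurableSet_Ioo) fun χ hχ hχc hχs => ?_
    set φ : ℝ → E3 → E3 := fun t x => χ t • ψ x with hφ
    have hφs : tsupport (fun p : ℝ × E3 => φ p.1 p.2) ⊆ tsupport χ ×ˢ tsupport ψ := by
      refine closure_minimal (fun p hp => ?_) ((isClosed_tsupport _).prod (isClosed_tsupport _))
      rw [Function.mem_support] at hp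
      exact ⟨subset_tsupport _ (left_ne_zero_of_smul hp),
        subset_tsupport _ (right_ne_zero_of_smul hp)⟩
    have hφd : ContDiff ℝ ∞ (fun p : ℝ × E3 => φ p.1 p.2) :=
      (hχ.comp contDiff_fst).smul (hψ.1.comp contDiff_snd)
    have hφt : IsSpaceTimeTestField Ω Te φ :=
      ⟨hφd, (hχc.isCompact.prod hψ.2.1.isCompact).of_isClosed_subset (isClosed_tsupport _) hφs,
        hφs.trans (prod_mono (hχs.trans hsub) (hψ.2.2.trans hK))⟩
    have hid := (W.weak_identity ℓ (g := g) hΩ hf hT hb hρ hc hcd hd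
      (hφd.of_le (by exact_mod_cast le_top)) (hφs.trans (prod_mono hχs hψ.2.2))).2.2
    rw [sub_eq_zero.2 (hsol φ hφt).2.2, eq_comm, mul_eq_zero,
      or_iff_right (norm_ne_zero_iff.2 hb)] at hid
    have hrot : ∀ t x, rot (φ t) x = χ t • rot ψ x := fun t x => by
      have hfd : fderiv ℝ (φ t) x = χ t • fderiv ℝ ψ x :=
        ((hψ1.differentiable (by norm_num) x).hasFDerivAt.fun_const_smul (χ t)).fderiv
      apply e3_ext <;> simp [rot_zero, rot_one, rot_two, partialDeriv, hfd, mul_sub]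
    simp only [hrot, inner_smul_left, intervalIntegral.integral_const_mul] at hid
    rw [← hid]
    symm
    refine setIntegral_eq_integral_of_forall_compl_eq_zero fun t ht => ?_
    have : χ t = 0 := image_eq_zero_of_notMem_tsupport fun h' => ht (hsub (hχs h'))
    simp [this]
  have hae' : h =ᵐ[volume.restrict (Ioo c d)] fun _ => 0 :=
    (ae_restrict_iff' measurableSet_Ioo).2 hae
  exact Measure.eqOn_open_of_ae_eq hae' isOpen_Ioo hcont continuousOn_const ht₀

lemma inner_deriv_defect (hg : ∀ t ∈ Ico 0 Te, ∀ s, inner ℝ g (deriv (ℓ.y t) s) = 0) {t s : ℝ}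
    (ht : t ∈ Ico 0 Te) : inner ℝ (deriv (ℓ.y t) s) (ℓ.defect f T b g t s) = 0 := by
  rw [defect, inner_sub_right, inner_smul_right, real_inner_comm, inner_cross_self_right,
    real_inner_comm g, hg t ht s]
  simp

lemma continuous_defect (hf : Continuous f)
    (hT : ContinuousOn (fun p : ℝ × E3 => T p.1 p.2) (Icc 0 Te ×ˢ closure Ω)) {t : ℝ}
    (ht : t ∈ Ico 0 Te) : Continuous (ℓ.defect f T b g t) := by
  rw [← continuousOn_univ]
  exact (ℓ.continuousOn_defect hf hT).comp (f := fun s => (t, s)) (by fun_prop)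
    fun s _ => ⟨ht, mem_univ _⟩

/-- Localization in time and then in space, which reaches interior times only, since space-time test
fields vanish near `t = 0`. -/
lemma defect_eq_zero_of_solves (hΩ : IsOpen Ω) (hf : Continuous f)
    (hT : ContinuousOn (fun p : ℝ × E3 => T p.1 p.2) (Icc 0 Te ×ˢ closure Ω)) (hb : b ≠ 0)
    (hg : ∀ t ∈ Ico 0 Te, ∀ s, inner ℝ g (deriv (ℓ.y t) s) = 0)
    {ρ : ℝ → DislocationMeasure Ω} (hρ : ∀ t ∈ Ico 0 Te, ℓ.IsDislocationMeasureOf b t (ρ t))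
    (hsol : SolvesSlipPlaneEquation Te f T b g ρ) {t : ℝ} (ht : t ∈ Ioo 0 Te) (s : ℝ) :
    ℓ.defect f T b g t s = 0 := by
  have ht' := Ioo_subset_Ico_self ht
  obtain ⟨r, hr, hrΩ⟩ := Metric.nhds_basis_closedBall.mem_iff.1 (hΩ.mem_nhds (ℓ.mem t ht' s))
  obtain ⟨c, hc1, hc2⟩ := exists_between ht.1
  obtain ⟨d, hd1, hd2⟩ := exists_between ht.2
  obtain ⟨α, β, W⟩ := ℓ.exists_window s (isCompact_closedBall (ℓ.y t s) r) hrΩ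
    (isCompact_Icc (a := c) (b := d)) (fun t ht => ⟨(hc1.trans_le ht.1).le, ht.2.trans_lt hd2⟩)
  have hm := ℓ.continuous_defect (b := b) (g := g) hf hT ht'
  have hrot : ∀ ψ : E3 → E3, IsTestField (Metric.closedBall (ℓ.y t s) r) ψ →
      ∫ s in α..β, inner ℝ (rot ψ (ℓ.y t s)) (ℓ.defect f T b g t s) = 0 := fun ψ hψ =>
    W.integral_rot_defect_eq_zero ℓ hΩ hf hT hb hρ hsol hc1 ⟨hc2, hd1⟩ hd2 hrΩ hψ
  exact eq_zero_of_forall_integral_rot_eq_zero (γ := ℓ.y t) (m := ℓ.defect f T b g t)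
    (ℓ.continuous_y ht') (ℓ.hasDerivAt_param ht') (ℓ.regular t ht' s) hm
    (ℓ.inner_deriv_defect hg ht') W.left_lt W.lt_right (W.eq_of_eq t ht') hr hrot

/-- The vanishing of the defect extends from a dense set of parameters. -/
lemma defect_eq_zero_of_dense (hf : Continuous f)
    (hT : ContinuousOn (fun p : ℝ × E3 => T p.1 p.2) (Icc 0 Te ×ˢ closure Ω)) {D : Set (ℝ × ℝ)}
    (hD : D ⊆ Ico 0 Te ×ˢ univ) (hdense : Ico 0 Te ×ˢ univ ⊆ closure D)
    (h : ∀ p ∈ D, ℓ.defect f T b g p.1 p.2 = 0) {t s : ℝ} (ht : t ∈ Ico 0 Te) :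
    ℓ.defect f T b g t s = 0 := by
  have hcl : (t, s) ∈ closure D := hdense ⟨ht, mem_univ _⟩
  have hcw := ((ℓ.continuousOn_defect (g := g) (b := b) hf hT) (t, s) ⟨ht, mem_univ _⟩).mono hD
  have : (𝓝[D] (t, s)).NeBot := mem_closure_iff_nhdsWithin_neBot.1 hcl
  refine tendsto_nhds_unique (hcw.tendsto) ?_
  exact tendsto_const_nhds.congr' (eventually_nhdsWithin_of_forall fun p hp => (h p hp).symm)

/-- The curve solves the equation if and only if its defect vanishes. -/
lemma solves_iff_defect_eq_zero (hΩ : IsOpen Ω) (hTe : 0 < Te) (hf : Continuous f)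
    (hT : ContinuousOn (fun p : ℝ × E3 => T p.1 p.2) (Icc 0 Te ×ˢ closure Ω)) (hb : b ≠ 0)
    (hg : ∀ t ∈ Ico 0 Te, ∀ s, inner ℝ g (deriv (ℓ.y t) s) = 0)
    {ρ : ℝ → DislocationMeasure Ω} (hρ : ∀ t ∈ Ico 0 Te, ℓ.IsDislocationMeasureOf b t (ρ t)) :
    SolvesSlipPlaneEquation Te f T b g ρ ↔
      ∀ t ∈ Ico 0 Te, ∀ s, ℓ.defect f T b g t s = 0 := by
  refine ⟨fun hsol t ht s => ?_, ℓ.solves_of_defect_eq_zero hΩ hTe hf hT hb hρ⟩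
  -- The initial time is recovered by continuity of the defect up to `t = 0`.
  refine ℓ.defect_eq_zero_of_dense hf hT (D := Ioo 0 Te ×ˢ univ)
    (prod_mono_left Ioo_subset_Ico_self) ?_
    (fun p hp => ℓ.defect_eq_zero_of_solves hΩ hf hT hb hg hρ hsol hp.1 p.2) ht
  rw [closure_prod_eq, closure_Ioo hTe.ne, closure_univ]
  exact prod_mono_left Ico_subset_Icc_self

/-- The cross product with `∂ₛy = |∂ₛy| τ` discards the tangential part of `∂ₜy`, which depends on
the parametrization. What remains is the normal velocity, rotated by a right angle. -/
lemma defect_eq_zero_iff (hΩ : IsOpen Ω) (hf_odd : ∀ r : ℝ, f (-r) = -f r) (hg1 : ‖g‖ = 1)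
    (hbg : inner ℝ b g = 0) (hg : ∀ t ∈ Ico 0 Te, ∀ s, inner ℝ g (deriv (ℓ.y t) s) = 0)
    {t s : ℝ} (ht : t ∈ Ico 0 Te) : ℓ.defect f T b g t s = 0 ↔
      ℓ.HasNormalVelocityAt t s (speedAlong f (glideDir g (ℓ.tangent t s) b)
        (peachKoehler (T t (ℓ.y t s)) (ℓ.tangent t s) b)) := by
  have hτ := ℓ.norm_tangent (s := s) ht
  have hτg : inner ℝ (ℓ.tangent t s) g = 0 := by
    rw [tangent, inner_smul_left, real_inner_comm, hg t ht s, mul_zero]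
  rw [ℓ.hasNormalVelocityAt_iff hΩ ht, speedAlong_glideDir hf_odd hτ hg1 hτg hbg,
    ← cross_smul_sub_eq_zero_iff hτ hτg (ℓ.norm_deriv_pos ht (s := s)).ne',
    ℓ.norm_smul_tangent ht, defect]

end MovingCurve
end Dislocation

theorem corollary4p1
    (Ω : Set E3) (hΩ : IsOpen Ω) (Te : ℝ) (hTe : 0 < Te)
    (f : ℝ → ℝ) (hf : Continuous f) (hf_odd : ∀ r : ℝ, f (-r) = -f r)
    (T : ℝ → E3 → Matrix (Fin 3) (Fin 3) ℝ)
    (hT : ContinuousOn (fun p : ℝ × E3 => T p.1 p.2) (Set.Icc 0 Te ×ˢ closure Ω))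
    (hT_symm : ∀ t ∈ Set.Icc 0 Te, ∀ x ∈ closure Ω, (T t x).IsSymm)
    (b g : E3) (hb : b ≠ 0) (hg : ‖g‖ = 1) (hbg : inner ℝ b g = 0)
    (ℓ : MovingCurve Ω Te)
    (hplane : ∀ t ∈ Set.Ico 0 Te, ∃ c : ℝ, ∀ x ∈ ℓ.curve t, inner ℝ g x = c)
    (ρ : ℝ → DislocationMeasure Ω)
    (hρ : ∀ t ∈ Set.Ico 0 Te, ℓ.IsDislocationMeasureOf b t (ρ t)) :
    -- the equation holds iff the curve moves with normal velocity `f(b^{⊥τ} · F) b^{⊥τ}`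
    (SolvesSlipPlaneEquation Te f T b g ρ ↔
      ∀ t ∈ Set.Ico 0 Te, ∀ s : ℝ,
        ℓ.HasNormalVelocityAt t s
          (speedAlong f (glideDir g (ℓ.tangent t s) b)
            (peachKoehler (T t (ℓ.y t s)) (ℓ.tangent t s) b))) ∧
    -- if the non-screw points are dense, it suffices to consider these points
    (Set.Ico 0 Te ×ˢ Set.univ ⊆
        closure {p : ℝ × ℝ | p.1 ∈ Set.Ico 0 Te ∧ projNormal (ℓ.tangent p.1 p.2) b ≠ 0} →
      (SolvesSlipPlaneEquation Te f T b g ρ ↔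
        ∀ t ∈ Set.Ico 0 Te, ∀ s : ℝ, projNormal (ℓ.tangent t s) b ≠ 0 →
          ℓ.HasNormalVelocityAt t s
            (speedAlong f (bPerp (ℓ.tangent t s) b)
              (peachKoehler (T t (ℓ.y t s)) (ℓ.tangent t s) b)))) := by
  have hτ : ∀ t ∈ Set.Ico 0 Te, ∀ s, inner ℝ g (deriv (ℓ.y t) s) = 0 :=
    fun t ht s => ℓ.inner_deriv_eq_zero g hplane ht
  have hiff := ℓ.solves_iff_defect_eq_zero hΩ hTe hf hT hb hτ hρ
  have hpt : ∀ t ∈ Set.Ico 0 Te, ∀ s, _ ↔ _ := fun t ht s =>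
    ℓ.defect_eq_zero_iff (T := T) (s := s) hΩ hf_odd hg hbg hτ ht
  have hmain := hiff.trans (forall₃_congr hpt)
  refine ⟨hmain, fun hdense => ⟨fun hsol t ht s hs => ?_, fun h => hiff.2 fun t ht s => ?_⟩⟩
  · have := hmain.1 hsol t ht s
    rwa [glideDir, if_neg hs] at this
  -- Off the screw points the completed glide direction is `bPerp`, so the assumed velocities make
  -- the defect vanish on a dense set.
  · refine ℓ.defect_eq_zero_of_dense hf hT (fun p hp => ⟨hp.1, Set.mem_univ _⟩) hdense
      (fun p hp => ?_) ht
    rw [hpt p.1 hp.1, glideDir, if_neg hp.2]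
    exact h p.1 hp.1 p.2 hp.2
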